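/- Let $K$ be a number of receivers, let $\mathcal X,\mathcal W$ and $\mathcal Y_k,\mathcal U_k,\mathcal V_k$ ($1\le k\le K$) be finite alphabets, let $(X,Y_1,\dots,Y_K)$ be a source/side-information tuple with an arbitrary joint pmf on $\mathcal X\times\mathcal Y_1\times\cdots\times\mathcal Y_K$, and let $T(u_1,\dots,u_K\mid w)$ be an arbitrary conditional pmf (a memoryless broadcast channel from $\mathcal W$ to $\mathcal U_1\times\cdots\times\mathcal U_K$). Fix a rational bandwidth expansion factor $\kappa>0$, helper rates $\boldsymbol R=(R_1,\dots,R_K)$ with $R_k\ge 0$, and scalar quantisers $\boldsymbol\phi=(\phi_1,\dots,\phi_K)$, $\phi_k:\mathcal W\to\mathcal V_k$. An $(n_s,n_c,R_1,\dots,R_K)$-code consists of an encoder $f:\mathcal X^{n_s}\to\mathcal W^{n_c}$, helper encoders $f_k:\mathcal V_k^{n_c}\to\{1,\dots,\lfloor 2^{n_sR_k}\rfloor\}$ and decoders $g_k:\mathcal U_k^{n_c}\times\mathcal Y_k^{n_s}\times\{1,\dots,\lfloor 2^{n_sR_k}\rfloor\}\to\mathcal X^{n_s}$. The source emits $n_s$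 i.i.d. copies $(\mathbf X,\mathbf Y_1,\dots,\mathbf Y_K)$ of $(X,Y_1,\dots,Y_K)$; the codeword $\mathbf W=f(\mathbf X)$ is sent over $n_c$ uses of the memoryless channel $T$ and is received as $\mathbf U_k$ at receiver $k$; helper $k$ observes $\mathbf V_k=(\phi_k(W_1),\dots,\phi_k(W_{n_c}))$ and sends $M_k=f_k(\mathbf V_k)$ noiselessly to receiver $k$, which outputs $\hat{\mathbf X}_k=g_k(\mathbf U_k,\mathbf Y_k,M_k)$. The tuple $(X,Y_1,\dots,Y_K)$ is $(\kappa,\boldsymbol R,\boldsymbol\phi)$-achievable if for every $\epsilon>0$ and all sufficiently large $n_s,n_c$ with $n_c/n_s=\kappa$ there is an $(n_s,n_c,R_1,\dots,R_K)$-code with $\Pr[\hat{\mathbf X}_k\ne\mathbf X]\le\epsilon$ for all $k$. For a pmf $P_W$ on $\mathcal W$ let $(W,U_1,\dots,U_K)\sim P_W(\cdot)T(\cdot\mid\cdot)$ and $V_k=\phi_k(W)$; entropies and informations are in bits. Then: 1. If there is a pmf $P_W$ on $\mathcal W$ such that for all $k$ $$H(X\mid Y_k)<\kappa I(W;U_k)+\min\{R_k,\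 \kappa I(W;V_k\mid U_k)\},$$ then $(X,Y_1,\dots,Y_K)$ is $(\kappa,\boldsymbol R,\boldsymbol\phi)$-achievable. 2. If $(X,Y_1,\dots,Y_K)$ is $(\kappa,\boldsymbol R,\boldsymbol\phi)$-achievable, then there is a pmf $P_W$ on $\mathcal W$ such that for all $k$ $$H(X\mid Y_k)\le\kappa I(W;U_k)+\min\{R_k,\ \kappa I(W;V_k\mid U_k)\}.$$ The same conclusion holds if, for every $\epsilon>0$, such codes exist only for some arbitrarily large $n_s,n_c$ with $n_c/n_s=\kappa$. -/

import Mathlib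

noncomputable section

namespace BSCoop

/-! ### Entropies, in bits, of random variables on a finite probability space -/

section Entropy

variable {Ω α β γ : Type*}

/-- `Pr[A = a]` for a random variable `A` on the discrete probability space `(Ω, p)`. -/
def prob (p : PMF Ω) (A : Ω → α) (a : α) : ℝ := (p.map A a).toReal

/-- Shannon entropy `H(A)`. -/
def entropy [Fintype α] (p : PMF Ω) (A : Ω → α) : ℝ :=
  -∑ a, prob p A a * Real.logb 2 (prob p A a)

/-- Conditional entropy `H(A|B) = -∑ Pr[A = a, B = b] log₂ Pr[A = a | B = b]`. Pairs of probability
zero contribute `0`. -/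
def condEntropy [Fintype α] [Fintype β] (p : PMF Ω) (A : Ω → α) (B : Ω → β) : ℝ :=
  -∑ a, ∑ b, prob p (fun ω => (A ω, B ω)) (a, b) *
    Real.logb 2 (prob p (fun ω => (A ω, B ω)) (a, b) / prob p B b)

/-- Mutual information `I(A;B) = H(A) - H(A|B)`. -/
def mutualInfo [Fintype α] [Fintype β] (p : PMF Ω) (A : Ω → α) (B : Ω → β) : ℝ :=
  entropy p A - condEntropy p A B

/-- Conditional mutual information `I(A;B|C) = H(A|C) - H(A|B,C)`. -/
def condMutualInfo [Fintype α] [Fintype β] [Fintype γ] (p : PMF Ω)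
    (A : Ω → α) (B : Ω → β) (C : Ω → γ) : ℝ :=
  condEntropy p A C - condEntropy p A (fun ω => (B ω, C ω))

end Entropy

/-! ### The base-station cooperation model, Mode 1 -/

section Model

variable {K : ℕ} {X W : Type*} {Y U V : Fin K → Type*}

/-- The joint law of `(W, (U_1, …, U_K)) ∼ P_W(·) T(·|·)`. -/
def channelLaw (PW : PMF W) (T : W → PMF (∀ k, U k)) : PMF (W × (∀ k, U k)) :=
  PW.bind fun w => (T w).map (Prod.mk w)

/-- The number `⌊2 ^ (n_s r)⌋` of messages of a helper of rate `r`, in bits per source symbol. -/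
def numMessages (ns : ℕ) (r : ℝ) : ℕ := ⌊(2 : ℝ) ^ ((ns : ℝ) * r)⌋₊

/-- An `(n_s, n_c, R_1, …, R_K)`-code. -/
structure Code (X W : Type*) (Y U V : Fin K → Type*) (ns nc : ℕ) (R : Fin K → ℝ) where
  /-- encoder `f` of the main base station -/
  enc : (Fin ns → X) → (Fin nc → W)
  /-- encoder `f_k` of helper `k` -/
  helper : ∀ k, (Fin nc → V k) → Fin (numMessages ns (R k))
  /-- decoder `g_k` of receiver `k` -/
  dec : ∀ k, (Fin nc → U k) → (Fin ns → Y k) → Fin (numMessages ns (R k)) → (Fin ns → X)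

variable {ns nc : ℕ} {R : Fin K → ℝ}

/-- Receiver `k`'s reconstruction when the source emits `x`, the side information at receiver `k`
is `y` and the channel output at receiver `k` is `u`; helper `k` observes the symbol-by-symbol
quantised codeword. -/
def Code.reconstruct (c : Code X W Y U V ns nc R) (φ : ∀ k, W → V k) (k : Fin K)
    (x : Fin ns → X) (y : Fin ns → Y k) (u : Fin nc → U k) : Fin ns → X :=
  c.dec k u y (c.helper k fun j => φ k (c.enc x j))

open Classical in
/-- `Pr[X̂_k ≠ X]`: the source and side information `z` are i.i.d. with law `P`, and, given the
codeword, the channel outputs `u` are drawn from the memoryless channel `T`. -/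
def Code.errorProb [Fintype X] [∀ k, Fintype (Y k)] [∀ k, Fintype (U k)]
    (c : Code X W Y U V ns nc R) (P : PMF (X × (∀ k, Y k))) (T : W → PMF (∀ k, U k))
    (φ : ∀ k, W → V k) (k : Fin K) : ℝ :=
  ∑ z : Fin ns → X × (∀ k, Y k), ∑ u : Fin nc → (∀ k, U k),
    if c.reconstruct φ k (fun i => (z i).1) (fun i => (z i).2 k) (fun j => u j k)
        ≠ (fun i => (z i).1) then
      (∏ i, (P (z i)).toReal) * ∏ j, (T (c.enc (fun i => (z i).1) j) (u j)).toReal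
    else 0

/-- `(κ, R, φ)`-achievability: for every `ε > 0` there are, for all sufficiently large blocklengths
with `n_c / n_s = κ`, codes with error probability at most `ε` at every receiver. -/
def Achievable [Fintype X] [∀ k, Fintype (Y k)] [∀ k, Fintype (U k)]
    (P : PMF (X × (∀ k, Y k))) (T : W → PMF (∀ k, U k)) (κ : ℚ) (R : Fin K → ℝ)
    (φ : ∀ k, W → V k) : Prop :=
  ∀ ε : ℝ, 0 < ε → ∃ N : ℕ, ∀ ns nc : ℕ, N ≤ ns → N ≤ nc → (nc : ℚ) / (ns : ℚ) = κ →
    ∃ c : Code X W Y U V ns nc R, ∀ k, c.errorProb P T φ k ≤ ε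

/-- The weaker notion in which codes are required for some arbitrarily large blocklengths only. -/
def WeaklyAchievable [Fintype X] [∀ k, Fintype (Y k)] [∀ k, Fintype (U k)]
    (P : PMF (X × (∀ k, Y k))) (T : W → PMF (∀ k, U k)) (κ : ℚ) (R : Fin K → ℝ)
    (φ : ∀ k, W → V k) : Prop :=
  ∀ ε : ℝ, 0 < ε → ∀ N : ℕ, ∃ ns nc : ℕ, N ≤ ns ∧ N ≤ nc ∧ (nc : ℚ) / (ns : ℚ) = κ ∧
    ∃ c : Code X W Y U V ns nc R, ∀ k, c.errorProb P T φ k ≤ ε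

/-- `H(X|Y_k)`. -/
def sourceEquivocation [Fintype X] [∀ k, Fintype (Y k)]
    (P : PMF (X × (∀ k, Y k))) (k : Fin K) : ℝ :=
  condEntropy P (fun z => z.1) (fun z => z.2 k)

/-- `κ I(W;U_k) + min {R_k, κ I(W;V_k|U_k)}`, where `(W, U_1, …, U_K) ∼ P_W(·) T(·|·)` and
`V_k = φ_k(W)`. -/
def helperBound [Fintype W] [∀ k, Fintype (U k)] [∀ k, Fintype (V k)]
    (PW : PMF W) (T : W → PMF (∀ k, U k)) (κ : ℚ) (R : Fin K → ℝ) (φ : ∀ k, W → V k)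
    (k : Fin K) : ℝ :=
  (κ : ℝ) * mutualInfo (channelLaw PW T) (fun s => s.1) (fun s => s.2 k) +
    min (R k) ((κ : ℝ) *
      condMutualInfo (channelLaw PW T) (fun s => s.1) (fun s => φ k s.1) (fun s => s.2 k))

end Model

end BSCoop

end

/-
Achievability: all codewords are drawn independently from `P_W`, and each helper's observations are
thrown into random bins, so that the helper sends the bin of what it sees. The receiver looks for a
source word that is likely given the side information and whose codeword passes a likelihood-ratio
threshold test with the channel output, also when its own quantisation is adjoined to that output. A
false candidate with a quantisation different from the true one must collide with it in a bin, which
costs `2 ^ (-n_s R_k)` on top of `2 ^ (-n_c I(W;U_k))`; one with the same quantisation passes the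
test of the channel with output `(V_k, U_k)`, which costs `2 ^ (-n_c I(W;V_k,U_k))`. Since
`I(W;U_k) + I(W;V_k|U_k) = I(W;V_k,U_k)`, these two exponents are the two branches of the minimum.

Converse: Gibbs' inequality compares the true law with a posterior that guesses the helper's message
uniformly and mixes the decoder's output with a uniform symbol; this bounds `n_s H(X|Y_k)` by a
relative entropy of the channel, plus `log` of the number of messages and a term that is `o(n_s)`.
The reference law of the channel output is a product, driven by the law of the codeword letter at a
uniformly random time; this input law is the same for all receivers. Applied to the channel with
output `U_k` and the helper's message, and to the channel with output `(V_k, U_k)` and no message,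
the bound gives the two branches; compactness of the simplex removes the slack.
-/

noncomputable section

namespace BSCoop

open Filter Topology

open Real (logb)

/-! ### Finite probability -/

section Expectation

variable {ι α β : Type*}

/-- The real-valued probability mass function of `p`. -/
def mass (p : PMF α) (a : α) : ℝ := (p a).toReal

/-- The indicator of a proposition, as a real number. -/
def ind (q : Prop) : ℝ := open Classical in if q then 1 else 0

/-- The expectation of `f` under `p`, as a finite sum. -/
def mean [Fintype α] (p : PMF α) (f : α → ℝ) : ℝ := ∑ a, mass p a * f a

/-- The probability of the event `E` under `p`. -/
def pr [Fintype α] (p : PMF α) (E : α → Prop) : ℝ := mean p fun a => ind (E a)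

/-- The joint law of a `p`-distributed input and the corresponding output of the channel `S`. -/
def joint (p : PMF α) (S : α → PMF β) : PMF (α × β) := p.bind fun a => (S a).map (Prod.mk a)

theorem mass_nonneg (p : PMF α) (a : α) : 0 ≤ mass p a := ENNReal.toReal_nonneg

theorem mass_eq_zero_iff {p : PMF α} {a : α} : mass p a = 0 ↔ a ∉ p.support := by
  simp [mass, ENNReal.toReal_eq_zero_iff, p.apply_ne_top]

theorem mass_pos_iff {p : PMF α} {a : α} : 0 < mass p a ↔ a ∈ p.support := by
  rw [(mass_nonneg p a).lt_iff_ne', ne_eq, mass_eq_zero_iff, not_not]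

theorem mass_injective : Function.Injective (mass : PMF α → α → ℝ) := fun p q h =>
  PMF.ext fun a => (ENNReal.toReal_eq_toReal_iff' (p.apply_ne_top a) (q.apply_ne_top a)).1
    (congrFun h a)

theorem sum_mass [Fintype α] (p : PMF α) : ∑ a, mass p a = 1 := by
  simp only [mass]
  rw [← ENNReal.toReal_sum fun a _ => p.apply_ne_top a, ← ENNReal.toReal_one, ← p.tsum_coe,
    tsum_fintype]

theorem mass_uniformOfFintype [Fintype α] [Nonempty α] (a : α) :
    mass (PMF.uniformOfFintype α) a = (Fintype.card α : ℝ)⁻¹ := by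
  rw [mass, PMF.uniformOfFintype_apply, ENNReal.toReal_inv, ENNReal.toReal_natCast]

theorem ind_of_true {q : Prop} (h : q) : ind q = 1 := if_pos h

theorem ind_of_false {q : Prop} (h : ¬q) : ind q = 0 := if_neg h

theorem ind_mono {q r : Prop} (h : q → r) : ind q ≤ ind r := by
  unfold ind; split_ifs <;> simp_all

theorem ind_nonneg (q : Prop) : 0 ≤ ind q := by
  unfold ind; split_ifs <;> norm_num

theorem ind_and (q r : Prop) : ind (q ∧ r) = ind q * ind r := by
  unfold ind; split_ifs <;> simp_all

theorem ind_or_le (q r : Prop) : ind (q ∨ r) ≤ ind q + ind r := by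
  unfold ind; split_ifs <;> simp_all

theorem ind_exists_le [Fintype α] (E : α → Prop) : ind (∃ a, E a) ≤ ∑ a, ind (E a) := by
  by_cases h : ∃ a, E a
  · obtain ⟨a, ha⟩ := h
    rw [ind_of_true ⟨a, ha⟩, ← ind_of_true ha]
    exact Finset.single_le_sum (fun b _ => ind_nonneg (E b)) (Finset.mem_univ a)
  · rw [ind_of_false h]
    exact Finset.sum_nonneg fun a _ => ind_nonneg (E a)

theorem prod_ind [Fintype ι] (q : ι → Prop) : ∏ i, ind (q i) = ind (∀ i, q i) := by
  by_cases h : ∀ i, q i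
  · rw [ind_of_true h]
    exact Finset.prod_eq_one fun i _ => ind_of_true (h i)
  · rw [ind_of_false h]
    obtain ⟨i, hi⟩ := not_forall.1 h
    exact Finset.prod_eq_zero (Finset.mem_univ i) (ind_of_false hi)

theorem sum_ind_eq_mul [Fintype α] (a : α) (f : α → ℝ) : ∑ b, ind (a = b) * f b = f a := by
  classical simp [ind]

theorem mass_joint (p : PMF α) (S : α → PMF β) (a : α) (b : β) :
    mass (joint p S) (a, b) = mass p a * mass (S a) b := by
  classical
  have h_apply : joint p S (a, b) = p a * S a b := by
    simp only [joint, PMF.bind_apply, PMF.map_apply, Prod.mk.injEq]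
    rw [tsum_eq_single a fun a' ha => by simp [ha.symm], tsum_eq_single b fun b' hb => by
      simp [hb.symm]]
    simp
  rw [mass, h_apply, ENNReal.toReal_mul, mass, mass]

theorem mass_map_of_injective {h : α → β} (hh : Function.Injective h) (p : PMF α) (a : α) :
    mass (p.map h) (h a) = mass p a := by
  classical
  simp only [mass, PMF.map_apply, hh.eq_iff, tsum_ite_eq']

theorem mem_support_map_apply {p : PMF α} {a : α} (ha : a ∈ p.support) (h : α → β) :
    h a ∈ (p.map h).support :=
  (PMF.mem_support_map_iff _ _ _).2 ⟨a, ha, rfl⟩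

theorem mem_support_joint {p : PMF α} {S : α → PMF β} {s : α × β} :
    s ∈ (joint p S).support ↔ s.1 ∈ p.support ∧ s.2 ∈ (S s.1).support := by
  rw [← not_iff_not, ← mass_eq_zero_iff, mass_joint, mul_eq_zero, mass_eq_zero_iff,
    mass_eq_zero_iff, not_and_or]

theorem map_fst_joint (p : PMF α) (S : α → PMF β) : (joint p S).map Prod.fst = p := by
  simp only [joint, PMF.map_bind, PMF.map_comp]
  exact (congrArg p.bind (funext fun a => PMF.map_const (S a) a)).trans p.bind_pure

theorem map_snd_joint (p : PMF α) (S : α → PMF β) : (joint p S).map Prod.snd = p.bind S := by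
  simp only [joint, PMF.map_bind, PMF.map_comp]
  exact congrArg p.bind (funext fun a => PMF.map_id (S a))

variable [Fintype α] {p : PMF α} {f g : α → ℝ}

theorem mean_add (p : PMF α) (f g : α → ℝ) :
    mean p (fun a => f a + g a) = mean p f + mean p g := by
  simp only [mean, mul_add, Finset.sum_add_distrib]

theorem mean_neg (p : PMF α) (f : α → ℝ) : mean p (fun a => -f a) = -mean p f := by
  simp only [mean, mul_neg, Finset.sum_neg_distrib]

theorem mean_sub (p : PMF α) (f g : α → ℝ) :
    mean p (fun a => f a - g a) = mean p f - mean p g := by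
  simp only [mean, mul_sub, Finset.sum_sub_distrib]

theorem mean_const (p : PMF α) (c : ℝ) : mean p (fun _ => c) = c := by
  rw [mean, ← Finset.sum_mul, sum_mass, one_mul]

theorem mean_const_mul (p : PMF α) (c : ℝ) (f : α → ℝ) :
    mean p (fun a => c * f a) = c * mean p f := by
  simp only [mean, Finset.mul_sum, mul_left_comm]

theorem mean_mul_const (p : PMF α) (f : α → ℝ) (c : ℝ) :
    mean p (fun a => f a * c) = mean p f * c := by
  simp only [mean, Finset.sum_mul, mul_assoc]

theorem mean_sum (p : PMF α) (s : Finset ι) (f : ι → α → ℝ) :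
    mean p (fun a => ∑ i ∈ s, f i a) = ∑ i ∈ s, mean p (f i) := by
  simp only [mean, Finset.mul_sum]
  exact Finset.sum_comm

theorem mean_mono (h : ∀ a ∈ p.support, f a ≤ g a) : mean p f ≤ mean p g := by
  refine Finset.sum_le_sum fun a _ => ?_
  by_cases ha : a ∈ p.support
  · exact mul_le_mul_of_nonneg_left (h a ha) (mass_nonneg p a)
  · simp [mass_eq_zero_iff.2 ha]

theorem mean_congr (h : ∀ a ∈ p.support, f a = g a) : mean p f = mean p g :=
  le_antisymm (mean_mono fun a ha => (h a ha).le) (mean_mono fun a ha => (h a ha).ge)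

theorem mean_nonneg (h : ∀ a, 0 ≤ f a) : 0 ≤ mean p f :=
  Finset.sum_nonneg fun a _ => mul_nonneg (mass_nonneg p a) (h a)

theorem mean_comm [Fintype β] (p : PMF α) (q : PMF β) (F : α → β → ℝ) :
    mean p (fun a => mean q (F a)) = mean q fun b => mean p fun a => F a b := by
  simp only [mean, Finset.mul_sum, mul_left_comm (mass p _)]
  exact Finset.sum_comm

theorem exists_le_mean (p : PMF α) (f : α → ℝ) : ∃ a, f a ≤ mean p f := by
  by_contra! h
  have h_pos (a : α) : 0 ≤ mass p a * (f a - mean p f) :=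
    mul_nonneg (mass_nonneg p a) (sub_pos.2 (h a)).le
  have h_sum : ∑ a, mass p a * (f a - mean p f) = 0 := by
    change mean p (fun a => f a - mean p f) = 0
    rw [mean_sub, mean_const, sub_self]
  obtain ⟨a, ha⟩ := p.support_nonempty
  have h_zero := (Finset.sum_eq_zero_iff_of_nonneg fun a _ => h_pos a).1 h_sum a (Finset.mem_univ a)
  exact (mul_pos (mass_pos_iff.2 ha) (sub_pos.2 (h a))).ne' h_zero

theorem mean_pure (a : α) (f : α → ℝ) : mean (PMF.pure a) f = f a := by
  classical simp [mean, mass, PMF.pure_apply, apply_ite ENNReal.toReal]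

theorem mass_bind (p : PMF α) (q : α → PMF β) (b : β) :
    mass (p.bind q) b = mean p fun a => mass (q a) b := by
  simp only [mass, mean, PMF.bind_apply, tsum_fintype]
  rw [ENNReal.toReal_sum fun a _ => ENNReal.mul_ne_top (p.apply_ne_top a) ((q a).apply_ne_top b)]
  simp only [ENNReal.toReal_mul]

theorem mean_bind [Fintype β] (p : PMF α) (q : α → PMF β) (f : β → ℝ) :
    mean (p.bind q) f = mean p fun a => mean (q a) f := by
  simp only [mean, mass_bind, Finset.sum_mul, Finset.mul_sum, mul_assoc]
  exact Finset.sum_comm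

theorem mean_map [Fintype β] (p : PMF α) (h : α → β) (f : β → ℝ) :
    mean (p.map h) f = mean p fun a => f (h a) := by
  rw [← PMF.bind_pure_comp, mean_bind]
  simp only [Function.comp_apply, mean_pure]

theorem mass_eq_pr (p : PMF α) (a : α) : mass p a = pr p (· = a) := by
  classical simp [pr, mean, ind]

theorem mass_map (p : PMF α) (h : α → β) (b : β) : mass (p.map h) b = pr p fun a => h a = b := by
  classical
  simp only [← PMF.bind_pure_comp, mass_bind, pr]
  refine mean_congr fun a _ => ?_
  by_cases hb : h a = b <;> simp [mass, PMF.pure_apply, ind, hb, Ne.symm]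

theorem mean_joint [Fintype β] (p : PMF α) (S : α → PMF β) (f : α × β → ℝ) :
    mean (joint p S) f = mean p fun a => mean (S a) fun b => f (a, b) := by
  simp only [joint, mean_bind, mean_map]

theorem pr_mono {E F : α → Prop} (h : ∀ a ∈ p.support, E a → F a) : pr p E ≤ pr p F :=
  mean_mono fun a ha => ind_mono (h a ha)

theorem pr_nonneg (p : PMF α) (E : α → Prop) : 0 ≤ pr p E := mean_nonneg fun a => ind_nonneg (E a)

theorem pr_map [Fintype β] (p : PMF α) (h : α → β) (E : β → Prop) :
    pr (p.map h) E = pr p fun a => E (h a) :=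
  mean_map p h _

end Expectation

section ProductLaw

variable {ι : Type*} {A B : ι → Type*} [Fintype ι] [DecidableEq ι]
  [∀ i, Fintype (A i)] [∀ i, Fintype (B i)]

/-- The law of a family of independent random variables with laws `p i`. -/
def piLaw (p : ∀ i, PMF (A i)) : PMF (∀ i, A i) :=
  PMF.ofFintype (fun z => ∏ i, p i (z i)) <| by
    rw [← Fintype.piFinset_univ, ← Finset.prod_univ_sum]
    exact Finset.prod_eq_one fun i _ => (tsum_fintype _).symm.trans (p i).tsum_coe

theorem mass_piLaw (p : ∀ i, PMF (A i)) (z : ∀ i, A i) :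
    mass (piLaw p) z = ∏ i, mass (p i) (z i) := by
  simp only [mass, piLaw, PMF.ofFintype_apply, ENNReal.toReal_prod]

theorem mem_support_piLaw {p : ∀ i, PMF (A i)} {z : ∀ i, A i} :
    z ∈ (piLaw p).support ↔ ∀ i, z i ∈ (p i).support := by
  rw [← not_iff_not, ← mass_eq_zero_iff, mass_piLaw, Finset.prod_eq_zero_iff, not_forall]
  simp only [Finset.mem_univ, true_and, mass_eq_zero_iff]

theorem mean_piLaw_prod (p : ∀ i, PMF (A i)) (g : ∀ i, A i → ℝ) :
    mean (piLaw p) (fun z => ∏ i, g i (z i)) = ∏ i, mean (p i) (g i) := by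
  simp only [mean, mass_piLaw, ← Finset.prod_mul_distrib]
  rw [Finset.prod_univ_sum, Fintype.piFinset_univ]

theorem piLaw_map (p : ∀ i, PMF (A i)) (h : ∀ i, A i → B i) :
    (piLaw p).map (fun z i => h i (z i)) = piLaw fun i => (p i).map (h i) := by
  refine mass_injective (funext fun z => ?_)
  simp only [mass_map, mass_piLaw, pr, ← mean_piLaw_prod, prod_ind, funext_iff]

theorem piLaw_bind (p : ∀ i, PMF (A i)) (S : ∀ i, A i → PMF (B i)) :
    (piLaw p).bind (fun w => piLaw fun i => S i (w i)) = piLaw fun i => (p i).bind (S i) := by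
  refine mass_injective (funext fun z => ?_)
  simp only [mass_bind, mass_piLaw, ← mean_piLaw_prod]

theorem piLaw_map_apply (p : ∀ i, PMF (A i)) (i : ι) : (piLaw p).map (· i) = p i := by
  refine mass_injective (funext fun a => ?_)
  rw [mass_map, mass_eq_pr]
  calc pr (piLaw p) (fun z => z i = a)
      = mean (piLaw p) fun z => ∏ j, if h : j = i then ind (h ▸ z j = a) else 1 :=
        mean_congr fun z _ => by
          rw [Fintype.prod_eq_single i fun j hj => dif_neg hj, dif_pos rfl]
    _ = _ := by
        rw [mean_piLaw_prod p fun j b => if h : j = i then ind (h ▸ b = a) else 1,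
          Fintype.prod_eq_single i fun j hj => ?_]
        · simp only [dif_pos, pr]
        · simp only [dif_neg hj, mean_const]

theorem mean_piLaw_apply (p : ∀ i, PMF (A i)) (i : ι) (g : A i → ℝ) :
    mean (piLaw p) (fun z => g (z i)) = mean (p i) g := by
  rw [← mean_map _ fun z : ∀ i, A i => z i, piLaw_map_apply]

theorem mean_piLaw_sum (p : ∀ i, PMF (A i)) (g : ∀ i, A i → ℝ) :
    mean (piLaw p) (fun z => ∑ i, g i (z i)) = ∑ i, mean (p i) (g i) := by
  simp only [mean_sum, mean_piLaw_apply]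

end ProductLaw

section Iid

variable {ι α β : Type*} [Fintype ι] [DecidableEq ι] [Fintype α] [Fintype β]

/-- The law of a family, indexed by `ι`, of independent random variables with common law `p`. -/
abbrev iid (ι : Type*) [Fintype ι] [DecidableEq ι] (p : PMF α) : PMF (ι → α) := piLaw fun _ => p

/-- The memoryless extension of the channel `S` to words indexed by `ι`. -/
abbrev memoryless (S : α → PMF β) (w : ι → α) : PMF (ι → β) := piLaw fun i => S (w i)

theorem iid_map (p : PMF α) (h : α → β) :
    (iid ι p).map (fun z i => h (z i)) = iid ι (p.map h) :=
  piLaw_map (fun _ => p) fun _ => h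

theorem mean_iid_mul (p : PMF α) {i j : ι} (hij : i ≠ j) (f g : α → ℝ) :
    mean (iid ι p) (fun z => f (z i) * g (z j)) = mean p f * mean p g := by
  let h (k : ι) (a : α) : ℝ := if k = i then f a else if k = j then g a else 1
  have h_other (k : ι) (hk : k ≠ i ∧ k ≠ j) : h k = fun _ => 1 := by
    simp only [h, if_neg hk.1, if_neg hk.2]
  have h_left : h i = f := by simp only [h, if_pos]
  have h_right : h j = g := by simp only [h, if_neg hij.symm, if_pos]
  calc mean (iid ι p) (fun z => f (z i) * g (z j))
      = mean (iid ι p) fun z => ∏ k, h k (z k) := mean_congr fun z _ => by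
        rw [Fintype.prod_eq_mul i j hij fun k hk => by rw [h_other k hk], h_left, h_right]
    _ = mean p f * mean p g := by
        rw [mean_piLaw_prod, Fintype.prod_eq_mul i j hij fun k hk => by
          rw [h_other k hk, mean_const], h_left, h_right]

theorem mean_iid_pair (p : PMF α) {i j : ι} (hij : i ≠ j) (F : α → α → ℝ) :
    mean (iid ι p) (fun z => F (z i) (z j)) = mean p fun a => mean p (F a) := by
  calc mean (iid ι p) (fun z => F (z i) (z j))
      = mean (iid ι p) fun z => ∑ a, ind (z i = a) * F a (z j) := by simp only [sum_ind_eq_mul]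
    _ = ∑ a, mean p (fun b => ind (b = a)) * mean p (F a) := by
        rw [mean_sum]
        exact Finset.sum_congr rfl fun a _ => mean_iid_mul p hij (fun b => ind (b = a)) (F a)
    _ = mean p fun a => mean p (F a) :=
        Finset.sum_congr rfl fun a _ => congrArg (· * _) (mass_eq_pr p a).symm

theorem iid_joint (p : PMF α) (S : α → PMF β) :
    iid ι (joint p S) =
      (iid ι p).bind fun w => (memoryless S w).map fun u i => (w i, u i) := by
  rw [iid, joint, ← piLaw_bind]
  exact congrArg _ (funext fun w => (piLaw_map (fun i => S (w i)) fun i => Prod.mk (w i)).symm)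

theorem mean_iid_joint (p : PMF α) (S : α → PMF β) (F : (ι → α × β) → ℝ) :
    mean (iid ι (joint p S)) F =
      mean (iid ι p) fun w => mean (memoryless S w) fun u => F fun i => (w i, u i) := by
  simp only [iid_joint, mean_bind, mean_map]

end Iid

/-! ### Information measures and the block model -/

section Information

variable {Ω α β : Type*}

theorem support_subset_support_bind (Q : PMF α) (S : α → PMF β) {w : α} (hw : w ∈ Q.support) :
    (S w).support ⊆ (Q.bind S).support := fun _ hb =>
  (PMF.mem_support_bind_iff Q S _).2 ⟨w, hw, hb⟩

variable [Fintype α] [Fintype β]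

/-- The conditional entropy, in bits, of the first component of a `p`-distributed pair given the
second one. -/
def equivocation (p : PMF (α × β)) : ℝ :=
  mean p fun z => logb 2 (mass (p.map Prod.snd) z.2 / mass p z)

/-- The relative entropy of `p` with respect to `q`, in bits. It is only meaningful if the support
of `p` is contained in that of `q`. -/
def relEntropy (p q : PMF α) : ℝ := mean p fun a => logb 2 (mass p a / mass q a)

/-- The mutual information, in bits, between a `Q`-distributed input and the corresponding output
of the channel `S`. -/
def channelInfo (Q : PMF α) (S : α → PMF β) : ℝ := mean Q fun w => relEntropy (S w) (Q.bind S)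

theorem condEntropy_eq_equivocation (p : PMF Ω) (A : Ω → α) (B : Ω → β) :
    condEntropy p A B = equivocation (p.map fun ω => (A ω, B ω)) := by
  have h_snd : (p.map fun ω => (A ω, B ω)).map Prod.snd = p.map B := by
    rw [PMF.map_comp]; rfl
  rw [equivocation, h_snd, mean, Fintype.sum_prod_type, condEntropy, ← Finset.sum_neg_distrib]
  refine Finset.sum_congr rfl fun a _ => ?_
  rw [← Finset.sum_neg_distrib]
  refine Finset.sum_congr rfl fun b _ => ?_
  rw [← mul_neg, ← Real.logb_inv, inv_div]
  rfl

theorem entropy_sub_equivocation_joint (Q : PMF α) (S : α → PMF β) :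
    -mean Q (fun w => logb 2 (mass Q w)) - equivocation (joint Q S) = channelInfo Q S := by
  have h_marginal : mean Q (fun w => logb 2 (mass Q w)) =
      mean Q fun w => mean (S w) fun _ => logb 2 (mass Q w) := by simp only [mean_const]
  rw [equivocation, map_snd_joint, mean_joint, h_marginal, channelInfo, ← mean_neg, ← mean_sub]
  refine mean_congr fun w hw => ?_
  rw [relEntropy, ← mean_neg, ← mean_sub]
  refine mean_congr fun b hb => ?_
  have h_in := (mass_pos_iff.2 hw).ne'
  have h_channel := (mass_pos_iff.2 hb).ne'
  have h_out := (mass_pos_iff.2 (support_subset_support_bind Q S hw hb)).ne'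
  rw [mass_joint, Real.logb_div h_out (mul_ne_zero h_in h_channel), Real.logb_mul h_in h_channel,
    Real.logb_div h_channel h_out]
  ring

end Information

section Model

variable {K : ℕ} {X W : Type*} {Y U V : Fin K → Type*}

/-- The law of the source together with the side information of receiver `k`. -/
def receiverSource (P : PMF (X × ∀ k, Y k)) (k : Fin K) : PMF (X × Y k) :=
  P.map fun z => (z.1, z.2 k)

theorem map_fst_receiverSource (P : PMF (X × ∀ k, Y k)) (k : Fin K) :
    (receiverSource P k).map Prod.fst = P.map Prod.fst :=
  PMF.map_comp _ _ _

/-- The channel from the base station to receiver `k`. -/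
def receiverChannel (T : W → PMF (∀ k, U k)) (k : Fin K) (w : W) : PMF (U k) := (T w).map (· k)

/-- The channel whose output is that of `S` together with the quantised input: what a receiver
would observe if a genie revealed the observation of its helper. -/
def genieChannel {B D : Type*} (φ : W → D) (S : W → PMF B) (w : W) : PMF (D × B) :=
  (S w).map (Prod.mk (φ w))

theorem genieChannel_receiverChannel (T : W → PMF (∀ k, U k)) (φ : ∀ k, W → V k) (k : Fin K) :
    genieChannel (φ k) (receiverChannel T k) = fun w => (T w).map fun u => (φ k w, u k) :=
  funext fun _ => PMF.map_comp _ _ _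

theorem mutualInfo_channelLaw {B : Type*} [Fintype W] [Fintype B] (PW : PMF W)
    (T : W → PMF (∀ k, U k)) (h : W → (∀ k, U k) → B) :
    mutualInfo (channelLaw PW T) (fun s => s.1) (fun s => h s.1 s.2) =
      channelInfo PW fun w => (T w).map (h w) := by
  have h_pair : ((channelLaw PW T).map fun s => (s.1, h s.1 s.2)) =
      joint PW fun w => (T w).map (h w) := by
    simp only [channelLaw, joint, PMF.map_bind, PMF.map_comp]
    rfl
  rw [mutualInfo, condEntropy_eq_equivocation, h_pair, ← entropy_sub_equivocation_joint]
  simp only [entropy, prob, show (channelLaw PW T).map (fun s => s.1) = PW from map_fst_joint PW T]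
  rfl

theorem sourceEquivocation_eq [Fintype X] [∀ k, Fintype (Y k)] (P : PMF (X × ∀ k, Y k))
    (k : Fin K) : sourceEquivocation P k = equivocation (receiverSource P k) :=
  condEntropy_eq_equivocation P _ _

theorem helperBound_eq [Fintype W] [∀ k, Fintype (U k)] [∀ k, Fintype (V k)] (PW : PMF W)
    (T : W → PMF (∀ k, U k)) (κ : ℚ) (R : Fin K → ℝ) (φ : ∀ k, W → V k) (k : Fin K) :
    helperBound PW T κ R φ k = min (κ * channelInfo PW (receiverChannel T k) + R k)
      (κ * channelInfo PW (genieChannel (φ k) (receiverChannel T k))) := by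
  have h_receiver := mutualInfo_channelLaw PW T fun _ u => u k
  have h_genie := mutualInfo_channelLaw PW T fun w u => (φ k w, u k)
  have h_chain : mutualInfo (channelLaw PW T) (fun s => s.1) (fun s => s.2 k) +
      condMutualInfo (channelLaw PW T) (fun s => s.1) (fun s => φ k s.1) (fun s => s.2 k) =
      mutualInfo (channelLaw PW T) (fun s => s.1) (fun s => (φ k s.1, s.2 k)) :=
    sub_add_sub_cancel _ _ _
  rw [helperBound, ← min_add_add_left, ← mul_add, h_chain, h_receiver, h_genie]
  rw [genieChannel_receiverChannel]
  rfl

end Model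

section DecodingError

variable {𝒳 𝒴 𝒰 C : Type*} [Fintype 𝒳] [Fintype 𝒴] [Fintype 𝒰]

/-- The error probability of the decoder `g` in the one-shot problem in which the source and the
side information have joint law `p`, the channel output given the source symbol `x` has law `S x`,
and the helper's message is `m x`. Blocks are treated as single letters. -/
def decodingError (p : PMF (𝒳 × 𝒴)) (S : 𝒳 → PMF 𝒰) (m : 𝒳 → C) (g : 𝒰 → 𝒴 → C → 𝒳) : ℝ :=
  mean p fun z => pr (S z.1) fun u => g u z.2 (m z.1) ≠ z.1

theorem decodingError_nonneg (p : PMF (𝒳 × 𝒴)) (S : 𝒳 → PMF 𝒰) (m : 𝒳 → C)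
    (g : 𝒰 → 𝒴 → C → 𝒳) : 0 ≤ decodingError p S m g :=
  mean_nonneg fun _ => pr_nonneg _ _

end DecodingError

section Block

variable {α β : Type*} [Fintype α] [Fintype β]

/-- The joint law of two words of length `n` whose pairs of letters are independent with law `p`. -/
def blockSource (n : ℕ) (p : PMF (α × β)) : PMF ((Fin n → α) × (Fin n → β)) :=
  (iid (Fin n) p).map fun z => (fun i => (z i).1, fun i => (z i).2)

theorem mean_blockSource (n : ℕ) (p : PMF (α × β)) (f : (Fin n → α) × (Fin n → β) → ℝ) :
    mean (blockSource n p) f =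
      mean (iid (Fin n) p) fun z => f (fun i => (z i).1, fun i => (z i).2) :=
  mean_map _ _ _

theorem mass_blockSource (n : ℕ) (p : PMF (α × β)) (z : (Fin n → α) × (Fin n → β)) :
    mass (blockSource n p) z = ∏ i, mass p (z.1 i, z.2 i) := by
  have h_event (z' : Fin n → α × β) :
      ((fun i => (z' i).1, fun i => (z' i).2) = z) ↔ z' = fun i => (z.1 i, z.2 i) := by
    simp only [Prod.ext_iff, funext_iff, forall_and]
  simp only [blockSource, mass_map, h_event, ← mass_eq_pr, mass_piLaw]

theorem map_fst_blockSource (n : ℕ) (p : PMF (α × β)) :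
    (blockSource n p).map Prod.fst = iid (Fin n) (p.map Prod.fst) := by
  rw [blockSource, PMF.map_comp, ← iid_map]
  rfl

theorem map_snd_blockSource (n : ℕ) (p : PMF (α × β)) :
    (blockSource n p).map Prod.snd = iid (Fin n) (p.map Prod.snd) := by
  rw [blockSource, PMF.map_comp, ← iid_map]
  rfl

end Block

section Model

variable {K : ℕ} {X W : Type*} {Y U V : Fin K → Type*} [Fintype X] [∀ k, Fintype (Y k)]
  [∀ k, Fintype (U k)] {ns nc : ℕ} {R : Fin K → ℝ}

theorem blockSource_receiverSource (P : PMF (X × ∀ k, Y k)) (k : Fin K) (n : ℕ) :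
    blockSource n (receiverSource P k) =
      (iid (Fin n) P).map fun z => (fun i => (z i).1, fun i => (z i).2 k) := by
  rw [blockSource, receiverSource, ← iid_map, PMF.map_comp]
  rfl

theorem Code.errorProb_eq_mean (c : Code X W Y U V ns nc R) (P : PMF (X × ∀ k, Y k))
    (T : W → PMF (∀ k, U k)) (φ : ∀ k, W → V k) (k : Fin K) :
    c.errorProb P T φ k = mean (iid (Fin ns) P) fun z =>
      pr (memoryless T (c.enc fun i => (z i).1)) fun u =>
        c.reconstruct φ k (fun i => (z i).1) (fun i => (z i).2 k) (fun j => u j k) ≠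
          fun i => (z i).1 := by
  simp only [Code.errorProb, pr, mean, mass_piLaw, Finset.mul_sum, ind, mul_ite, mul_one, mul_zero]
  congr!

theorem Code.errorProb_eq_decodingError {B C : Type*} [Fintype B] (c : Code X W Y U V ns nc R)
    (P : PMF (X × ∀ k, Y k)) (T : W → PMF (∀ k, U k)) (φ : ∀ k, W → V k) (k : Fin K)
    (h : W → (∀ k, U k) → B) (m : (Fin ns → X) → C)
    (g : (Fin nc → B) → (Fin ns → Y k) → C → Fin ns → X)
    (hg : ∀ x y (u : Fin nc → ∀ k, U k), g (fun j => h (c.enc x j) (u j)) y (m x) =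
      c.reconstruct φ k x y fun j => u j k) :
    c.errorProb P T φ k = decodingError (blockSource ns (receiverSource P k))
      (fun x => memoryless (fun w => (T w).map (h w)) (c.enc x)) m g := by
  have h_output (w : Fin nc → W) : memoryless (fun w => (T w).map (h w)) w =
      (memoryless T w).map fun u j => h (w j) (u j) := (piLaw_map _ _).symm
  simp only [Code.errorProb_eq_mean, decodingError, blockSource_receiverSource, mean_map, h_output,
    pr_map, hg]

theorem Code.errorProb_eq_receiver (c : Code X W Y U V ns nc R) (P : PMF (X × ∀ k, Y k))
    (T : W → PMF (∀ k, U k)) (φ : ∀ k, W → V k) (k : Fin K) :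
    c.errorProb P T φ k = decodingError (blockSource ns (receiverSource P k))
      (fun x => memoryless (receiverChannel T k) (c.enc x))
      (fun x => c.helper k fun j => φ k (c.enc x j)) (c.dec k) :=
  c.errorProb_eq_decodingError P T φ k (fun _ u => u k) _ _ fun _ _ _ => rfl

theorem Code.errorProb_eq_genie [∀ k, Fintype (V k)] (c : Code X W Y U V ns nc R)
    (P : PMF (X × ∀ k, Y k)) (T : W → PMF (∀ k, U k)) (φ : ∀ k, W → V k) (k : Fin K) :
    c.errorProb P T φ k = decodingError (blockSource ns (receiverSource P k))
      (fun x => memoryless (genieChannel (φ k) (receiverChannel T k)) (c.enc x)) (fun _ => ())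
      (fun b y _ => c.dec k (fun j => (b j).2) y (c.helper k fun j => (b j).1)) := by
  rw [genieChannel_receiverChannel]
  exact c.errorProb_eq_decodingError P T φ k (fun w u => (φ k w, u k)) _ _ fun _ _ _ => rfl

end Model

/-! ### Random binning and achievability -/

section RandomCoding

variable {𝒳 𝒴 𝒲 𝒰 𝒱 C : Type*}

theorem mean_codebook_sum_le [Fintype 𝒳] [DecidableEq 𝒳] [Fintype 𝒲] (Q : PMF 𝒲)
    {H : 𝒲 → 𝒲 → ℝ} (hH : ∀ w w', 0 ≤ H w w') {q : 𝒳 → ℝ} (hq : ∀ x, 0 ≤ q x) {L : ℝ}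
    (hL : ∑ x, q x ≤ L) (x : 𝒳) :
    mean (iid 𝒳 Q) (fun F => ∑ x', ind (x' ≠ x) * (q x' * H (F x) (F x'))) ≤
      L * mean Q fun w => mean Q (H w) := by
  have h_mean : 0 ≤ mean Q fun w => mean Q (H w) :=
    mean_nonneg fun w => mean_nonneg fun w' => hH w w'
  rw [mean_sum]
  refine le_trans (Finset.sum_le_sum fun x' _ => ?_)
    ((Finset.sum_mul _ _ _).symm.trans_le (mul_le_mul_of_nonneg_right hL h_mean))
  rw [mean_const_mul, mean_const_mul]
  by_cases hx : x' = x
  · rw [ind_of_false (not_not.2 hx), zero_mul]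
    exact mul_nonneg (hq x') h_mean
  · rw [ind_of_true hx, one_mul, mean_iid_pair Q (Ne.symm hx)]

variable [Nonempty 𝒳]

/-- The source symbol `x` is a candidate for the decoder if it passes the source test `ok` with the
side information `y`, if its codeword passes the channel test `A` with the output `u`, also
jointly with its quantisation (the test `G`), and if that quantisation lies in the bin `m`. -/
def IsCandidate (ok : 𝒳 → 𝒴 → Prop) (A : 𝒲 → 𝒰 → Prop) (G : 𝒲 → 𝒱 × 𝒰 → Prop) (φ : 𝒲 → 𝒱)
    (F : 𝒳 → 𝒲) (f : 𝒱 → C) (u : 𝒰) (y : 𝒴) (m : C) (x : 𝒳) : Prop :=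
  ok x y ∧ A (F x) u ∧ G (F x) (φ (F x), u) ∧ f (φ (F x)) = m

/-- The decoder that outputs some candidate; its value is arbitrary if there is none. -/
def candidateDecoder (ok : 𝒳 → 𝒴 → Prop) (A : 𝒲 → 𝒰 → Prop) (G : 𝒲 → 𝒱 × 𝒰 → Prop) (φ : 𝒲 → 𝒱)
    (F : 𝒳 → 𝒲) (f : 𝒱 → C) (u : 𝒰) (y : 𝒴) (m : C) : 𝒳 :=
  Classical.epsilon (IsCandidate ok A G φ F f u y m)

theorem ind_epsilon_ne_le [Fintype 𝒳] (E : 𝒳 → Prop) (x : 𝒳) :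
    ind (Classical.epsilon E ≠ x) ≤ ind (¬E x) + ∑ x', ind (x' ≠ x ∧ E x') := by
  refine (ind_mono fun h => ?_).trans ((ind_or_le (¬E x) (∃ x', x' ≠ x ∧ E x')).trans
    (add_le_add_right (ind_exists_le _) _))
  exact (em (E x)).symm.imp_right fun hx => ⟨_, h, Classical.epsilon_spec ⟨x, hx⟩⟩

variable (ok : 𝒳 → 𝒴 → Prop) (A : 𝒲 → 𝒰 → Prop) (G : 𝒲 → 𝒱 × 𝒰 → Prop) (φ : 𝒲 → 𝒱)

/-- A wrong candidate either has the same quantisation as the true codeword, and then it passes the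
joint test with the true quantisation, or it has a different one, and then two bins collide. -/
theorem ind_candidateDecoder_ne_le [Fintype 𝒳] (F : 𝒳 → 𝒲) (f : 𝒱 → C) (x : 𝒳) (y : 𝒴) (u : 𝒰) :
    ind (candidateDecoder ok A G φ F f u y (f (φ (F x))) ≠ x) ≤
      ind (¬ok x y) + ind (¬A (F x) u) + ind (¬G (F x) (φ (F x), u)) +
        ∑ x', ind (x' ≠ x) * (ind (ok x' y) *
          (ind (φ (F x') ≠ φ (F x) ∧ f (φ (F x')) = f (φ (F x))) * ind (A (F x') u) +
            ind (G (F x') (φ (F x), u)))) := by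
  refine (ind_epsilon_ne_le _ x).trans (add_le_add ?_ (Finset.sum_le_sum fun x' _ => ?_))
  · calc ind (¬IsCandidate ok A G φ F f u y (f (φ (F x))) x)
        ≤ ind ((¬ok x y ∨ ¬A (F x) u) ∨ ¬G (F x) (φ (F x), u)) :=
          ind_mono fun h => by unfold IsCandidate at h; tauto
      _ ≤ _ := (ind_or_le _ _).trans (add_le_add_left (ind_or_le _ _) _)
  · rw [← ind_and (φ _ ≠ _ ∧ _)]
    have h_cases : x' ≠ x ∧ IsCandidate ok A G φ F f u y (f (φ (F x))) x' →
        x' ≠ x ∧ ok x' y ∧ (((φ (F x') ≠ φ (F x) ∧ f (φ (F x')) = f (φ (F x))) ∧ A (F x') u) ∨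
          G (F x') (φ (F x), u)) := by
      rintro ⟨hne, h_ok, hA, hG, hm⟩
      refine ⟨hne, h_ok, ?_⟩
      by_cases hφ : φ (F x') = φ (F x)
      · exact .inr (hφ ▸ hG)
      · exact .inl ⟨⟨hφ, hm⟩, hA⟩
    refine (ind_mono h_cases).trans ?_
    rw [ind_and, ind_and]
    gcongr
    exacts [ind_nonneg _, ind_nonneg _, ind_or_le _ _]

variable [Fintype 𝒰]

theorem pr_collision_le [Fintype 𝒱] [DecidableEq 𝒱] [Fintype C] [Nonempty C] (v v' : 𝒱) :
    pr (iid 𝒱 (PMF.uniformOfFintype C)) (fun f => v ≠ v' ∧ f v = f v') ≤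
      (Fintype.card C : ℝ)⁻¹ := by
  by_cases hv : v = v'
  · simp only [hv, ne_eq, not_true_eq_false, false_and, pr, ind_of_false not_false, mean_const]
    positivity
  · simp only [ne_eq, hv, not_false_eq_true, true_and, pr]
    rw [mean_iid_pair _ hv fun c c' => ind (c = c'), mean_comm]
    exact ((mean_congr fun c _ => (mass_eq_pr _ c).symm.trans (mass_uniformOfFintype c)).trans
      (mean_const _ _)).le

/-- The error probability of the candidate decoder for the codebook `F`, averaged over uniformly
random bins. -/
def binningError [Fintype 𝒳] [Fintype 𝒴] [Fintype 𝒱] [DecidableEq 𝒱] (C : Type*) [Fintype C]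
    [Nonempty C] (p : PMF (𝒳 × 𝒴)) (S : 𝒲 → PMF 𝒰) (F : 𝒳 → 𝒲) : ℝ :=
  mean (iid 𝒱 (PMF.uniformOfFintype C)) fun f =>
    decodingError p (fun x => S (F x)) (fun x => f (φ (F x))) (candidateDecoder ok A G φ F f)

variable [Fintype 𝒳]

theorem exists_decodingError_le_binningError [Fintype 𝒴] [Fintype 𝒱] [DecidableEq 𝒱] (C : Type*)
    [Fintype C] [Nonempty C] (p : PMF (𝒳 × 𝒴)) (S : 𝒲 → PMF 𝒰) (F : 𝒳 → 𝒲) :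
    ∃ f : 𝒱 → C, decodingError p (fun x => S (F x)) (fun x => f (φ (F x)))
      (candidateDecoder ok A G φ F f) ≤ binningError ok A G φ C p S F :=
  exists_le_mean _ _

theorem mean_bins_pr_ne_le [Fintype 𝒱] [DecidableEq 𝒱] [Fintype C] [Nonempty C] (S : 𝒲 → PMF 𝒰)
    (F : 𝒳 → 𝒲) (x : 𝒳) (y : 𝒴) :
    mean (iid 𝒱 (PMF.uniformOfFintype C)) (fun f => pr (S (F x)) fun u =>
        candidateDecoder ok A G φ F f u y (f (φ (F x))) ≠ x) ≤
      ind (¬ok x y) + pr (S (F x)) (fun u => ¬A (F x) u) +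
        pr (S (F x)) (fun u => ¬G (F x) (φ (F x), u)) +
        ∑ x', ind (x' ≠ x) * (ind (ok x' y) *
          ((Fintype.card C : ℝ)⁻¹ * pr (S (F x)) (A (F x')) +
            pr (S (F x)) fun u => G (F x') (φ (F x), u))) := by
  refine (mean_mono fun f _ => mean_mono fun u _ =>
    ind_candidateDecoder_ne_le ok A G φ F f x y u).trans ?_
  simp only [mean_add, mean_sum, mean_const_mul, mean_mul_const, mean_const, ← pr.eq_1]
  gcongr
  exacts [ind_nonneg _, ind_nonneg _, pr_nonneg _ _, pr_collision_le _ _]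

theorem mean_binningError_le [DecidableEq 𝒳] [Fintype 𝒲] [Fintype 𝒴] [Fintype 𝒱] [DecidableEq 𝒱]
    [Fintype C] [Nonempty C] (p : PMF (𝒳 × 𝒴)) (Q : PMF 𝒲) (S : 𝒲 → PMF 𝒰) {L : ℝ}
    (hL : ∀ y, ∑ x, ind (ok x y) ≤ L) :
    mean (iid 𝒳 Q) (binningError ok A G φ C p S) ≤
      pr p (fun z => ¬ok z.1 z.2) + mean Q (fun w => pr (S w) fun u => ¬A w u) +
        mean Q (fun w => pr (S w) fun u => ¬G w (φ w, u)) +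
        L * ((Fintype.card C : ℝ)⁻¹ * mean Q (fun w => mean Q fun w' => pr (S w) (A w')) +
          mean Q fun w => mean Q fun w' => pr (S w) fun u => G w' (φ w, u)) := by
  let H (w w' : 𝒲) : ℝ :=
    (Fintype.card C : ℝ)⁻¹ * pr (S w) (A w') + pr (S w) fun u => G w' (φ w, u)
  have hH (w w' : 𝒲) : 0 ≤ H w w' :=
    add_nonneg (mul_nonneg (by positivity) (pr_nonneg _ _)) (pr_nonneg _ _)
  have h_codebook (h : 𝒲 → ℝ) (x : 𝒳) : mean (iid 𝒳 Q) (fun F => h (F x)) = mean Q h :=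
    mean_piLaw_apply _ _ _
  have h_point (x : 𝒳) (y : 𝒴) :
      mean (iid 𝒳 Q) (fun F => mean (iid 𝒱 (PMF.uniformOfFintype C)) fun f => pr (S (F x)) fun u =>
        candidateDecoder ok A G φ F f u y (f (φ (F x))) ≠ x) ≤
      ind (¬ok x y) + mean Q (fun w => pr (S w) fun u => ¬A w u) +
        mean Q (fun w => pr (S w) fun u => ¬G w (φ w, u)) + L * mean Q fun w => mean Q (H w) := by
    refine (mean_mono fun F _ => mean_bins_pr_ne_le ok A G φ S F x y).trans ?_
    rw [mean_add, mean_add, mean_add, mean_const, h_codebook fun w => pr (S w) fun u => ¬A w u,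
      h_codebook fun w => pr (S w) fun u => ¬G w (φ w, u)]
    gcongr
    exact mean_codebook_sum_le Q hH (fun x' => ind_nonneg (ok x' y)) (hL y) x
  calc mean (iid 𝒳 Q) (binningError ok A G φ C p S)
      = mean p fun z => mean (iid 𝒳 Q) fun F => mean (iid 𝒱 (PMF.uniformOfFintype C)) fun f =>
          pr (S (F z.1)) fun u => candidateDecoder ok A G φ F f u z.2 (f (φ (F z.1))) ≠ z.1 := by
        rw [mean_comm]
        exact mean_congr fun F _ => mean_comm _ _ _
    _ ≤ _ := mean_mono fun z _ => h_point z.1 z.2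
    _ = _ := by
        simp only [H, mean_add, mean_const, mean_const_mul]
        rfl

end RandomCoding

section LawOfLargeNumbers

variable {ι α : Type*} [Fintype ι] [DecidableEq ι] [Fintype α]

theorem mean_iid_sum_sq {p : PMF α} {f : α → ℝ} (hf : mean p f = 0) :
    mean (iid ι p) (fun z => (∑ i, f (z i)) ^ 2) = Fintype.card ι * mean p fun a => f a ^ 2 := by
  have h_row (i : ι) : ∑ j, mean (iid ι p) (fun z => f (z i) * f (z j)) =
      mean p fun a => f a ^ 2 := by
    rw [Fintype.sum_eq_single i fun j hj => by rw [mean_iid_mul p hj.symm, hf, zero_mul]]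
    simp only [← pow_two]
    exact mean_piLaw_apply (fun _ => p) i fun a => f a ^ 2
  simp only [pow_two, Finset.sum_mul_sum, mean_sum] at h_row ⊢
  simp only [h_row, Finset.sum_const, Finset.card_univ, nsmul_eq_mul]

theorem tendsto_pr_sum_le {p : PMF α} {g : α → ℝ} {t : ℝ} (ht : t < mean p g) :
    Tendsto (fun n : ℕ => pr (iid (Fin n) p) fun z => ∑ i, g (z i) ≤ n * t) atTop (𝓝 0) := by
  set d := mean p g - t with hd
  have h_pos : 0 < d := sub_pos.2 ht
  have h_centred : mean p (fun a => g a - mean p g) = 0 := by rw [mean_sub, mean_const, sub_self]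
  have h_chebyshev (n : ℕ) (hn : 0 < n) : pr (iid (Fin n) p) (fun z => ∑ i, g (z i) ≤ n * t) ≤
      (mean p fun a => (g a - mean p g) ^ 2) / d ^ 2 / n := by
    calc pr (iid (Fin n) p) (fun z => ∑ i, g (z i) ≤ n * t)
        ≤ mean (iid (Fin n) p) fun z =>
            ((n * d) ^ 2)⁻¹ * (∑ i, (g (z i) - mean p g)) ^ 2 := mean_mono fun z _ => by
          by_cases hz : ∑ i, g (z i) ≤ n * t
          · rw [ind_of_true hz, inv_mul_eq_div, one_le_div (by positivity), sq_le_sq,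
              abs_of_pos (by positivity), Finset.sum_sub_distrib, Finset.sum_const,
              Finset.card_univ, Fintype.card_fin, nsmul_eq_mul]
            exact le_abs.2 (.inr (by rw [hd]; linarith))
          · rw [ind_of_false hz]; positivity
      _ = (mean p fun a => (g a - mean p g) ^ 2) / d ^ 2 / n := by
          rw [mean_const_mul, mean_iid_sum_sq h_centred, Fintype.card_fin]
          field_simp
  exact squeeze_zero' (.of_forall fun n => pr_nonneg _ _)
    ((eventually_gt_atTop 0).mono h_chebyshev) (tendsto_const_div_atTop_nhds_zero_nat _)

theorem tendsto_pr_prod_le {p : PMF α} {f g : α → ℝ} (hf : ∀ a ∈ p.support, 0 < f a)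
    (hg : ∀ a ∈ p.support, 0 < g a) {t : ℝ} (ht : t < mean p fun a => logb 2 (f a / g a)) :
    Tendsto (fun n : ℕ => pr (iid (Fin n) p) fun z =>
      ∏ i, f (z i) ≤ (2 : ℝ) ^ (n * t) * ∏ i, g (z i)) atTop (𝓝 0) := by
  refine squeeze_zero (fun n => pr_nonneg _ _) (fun n => pr_mono fun z hz h => ?_)
    (tendsto_pr_sum_le ht)
  have hz' := mem_support_piLaw.1 hz
  have hfz (i : Fin n) : 0 < f (z i) := hf _ (hz' i)
  have hgz (i : Fin n) : 0 < g (z i) := hg _ (hz' i)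
  have h_ratio : ∏ i, f (z i) / g (z i) ≤ (2 : ℝ) ^ (n * t) := by
    rwa [Finset.prod_div_distrib, div_le_iff₀ (Finset.prod_pos fun i _ => hgz i)]
  rw [← Real.logb_prod _ _ fun i _ => (div_pos (hfz i) (hgz i)).ne']
  exact (Real.logb_le_iff_le_rpow one_lt_two
    (Finset.prod_pos fun i _ => div_pos (hfz i) (hgz i))).2 h_ratio

end LawOfLargeNumbers

section Typicality

variable {α β : Type*}

/-- The source symbol `x` has conditional probability greater than `s` given the side information
`y`. -/
def Likely (p : PMF (α × β)) (s : ℝ) (x : α) (y : β) : Prop :=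
  s * mass (p.map Prod.snd) y < mass p (x, y)

/-- The likelihood ratio between the output `b` being caused by the channel input `w` and it being
independent of `w` is greater than `t`. -/
def Exceeds (Q : PMF α) (S : α → PMF β) (t : ℝ) (w : α) (b : β) : Prop :=
  t * mass (Q.bind S) b < mass (S w) b

theorem mul_ind_mul_lt_le {t q m : ℝ} (ht : 0 < t) (hm : 0 ≤ m) :
    q * ind (t * q < m) ≤ t⁻¹ * m := by
  by_cases h : t * q < m
  · rw [ind_of_true h, mul_one, le_inv_mul_iff₀ ht]
    exact h.le
  · rw [ind_of_false h, mul_zero]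
    exact mul_nonneg (inv_nonneg.2 ht.le) hm

variable [Fintype α]

theorem mass_map_snd (p : PMF (α × β)) (b : β) :
    mass (p.map Prod.snd) b = ∑ a, mass p (a, b) := by
  classical
  simp only [mass, PMF.map_apply, ENNReal.tsum_prod', tsum_ite_eq', tsum_fintype]
  exact ENNReal.toReal_sum fun a _ => p.apply_ne_top _

theorem sum_ind_likely_le (p : PMF (α × β)) {s : ℝ} (hs : 0 < s) (y : β) :
    ∑ x, ind (Likely p s x y) ≤ s⁻¹ := by
  rcases (mass_nonneg (p.map Prod.snd) y).eq_or_lt' with hy | hy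
  · have h_mass (x : α) : mass p (x, y) = 0 :=
      (Finset.sum_eq_zero_iff_of_nonneg fun x _ => mass_nonneg p (x, y)).1
        ((mass_map_snd p y).symm.trans hy) x (Finset.mem_univ x)
    have h_unlikely (x : α) : ¬Likely p s x y := by simp [Likely, hy, h_mass]
    simp only [ind_of_false (h_unlikely _), Finset.sum_const_zero, inv_nonneg, hs.le]
  · refine le_of_mul_le_mul_left ?_ hy
    calc mass (p.map Prod.snd) y * ∑ x, ind (Likely p s x y)
        ≤ ∑ x, s⁻¹ * mass p (x, y) := by
          rw [Finset.mul_sum]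
          exact Finset.sum_le_sum fun x _ => mul_ind_mul_lt_le hs (mass_nonneg p (x, y))
      _ = mass (p.map Prod.snd) y * s⁻¹ := by rw [← Finset.mul_sum, ← mass_map_snd, mul_comm]

variable [Fintype β]

theorem pr_mul_mass_lt_le (q r : PMF β) {t : ℝ} (ht : 0 < t) :
    pr q (fun b => t * mass q b < mass r b) ≤ t⁻¹ :=
  calc pr q (fun b => t * mass q b < mass r b)
      ≤ ∑ b, t⁻¹ * mass r b := Finset.sum_le_sum fun b _ => mul_ind_mul_lt_le ht (mass_nonneg r b)
    _ = t⁻¹ := by rw [← Finset.mul_sum, sum_mass, mul_one]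

theorem mean_pr_exceeds_le (Q : PMF α) (S : α → PMF β) {t : ℝ} (ht : 0 < t) :
    mean Q (fun w => mean Q fun w' => pr (S w) (Exceeds Q S t w')) ≤ t⁻¹ := by
  rw [mean_comm]
  calc mean Q (fun w' => mean Q fun w => pr (S w) (Exceeds Q S t w'))
      = mean Q fun w' => pr (Q.bind S) (Exceeds Q S t w') :=
        mean_congr fun w' _ => (mean_bind Q S _).symm
    _ ≤ t⁻¹ := (mean_mono fun w' _ => pr_mul_mass_lt_le (Q.bind S) (S w') ht).trans_eq
        (mean_const Q _)

theorem tendsto_pr_not_likely (p : PMF (α × β)) {t : ℝ} (ht : t < -equivocation p) :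
    Tendsto (fun n : ℕ => pr (blockSource n p) fun z =>
      ¬Likely (blockSource n p) (2 ^ (n * t)) z.1 z.2) atTop (𝓝 0) := by
  have h_mean : -equivocation p =
      mean p fun z => logb 2 (mass p z / mass (p.map Prod.snd) z.2) := by
    simp only [equivocation, ← mean_neg, ← Real.logb_inv, inv_div]
  refine (tendsto_pr_prod_le (fun z hz => mass_pos_iff.2 hz) (fun z hz => mass_pos_iff.2 ?_)
    (ht.trans_eq h_mean)).congr fun n => ?_
  · exact mem_support_map_apply hz Prod.snd
  · simp only [pr, mean_blockSource, Likely, not_lt, map_snd_blockSource, mass_blockSource,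
      mass_piLaw]

theorem tendsto_mean_pr_not_exceeds (Q : PMF α) (S : α → PMF β) {t : ℝ}
    (ht : t < channelInfo Q S) :
    Tendsto (fun n : ℕ => mean (iid (Fin n) Q) fun w => pr (memoryless S w) fun b =>
      ¬Exceeds (iid (Fin n) Q) (memoryless S) (2 ^ (n * t)) w b) atTop (𝓝 0) := by
  have h_mean : channelInfo Q S =
      mean (joint Q S) fun s => logb 2 (mass (S s.1) s.2 / mass (Q.bind S) s.2) := by
    rw [mean_joint]; rfl
  refine (tendsto_pr_prod_le (fun s hs => mass_pos_iff.2 (mem_support_joint.1 hs).2)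
    (fun s hs => mass_pos_iff.2 ?_) (ht.trans_eq h_mean)).congr fun n => ?_
  · exact support_subset_support_bind Q S (mem_support_joint.1 hs).1 (mem_support_joint.1 hs).2
  · simp only [pr, mean_iid_joint, Exceeds, not_lt, piLaw_bind (fun _ => Q) fun _ => S, mass_piLaw]

end Typicality

section OneShotAchievability

variable {𝒳 𝒴 𝒲 𝒰 𝒱 : Type*} [Fintype 𝒳] [Fintype 𝒴] [Fintype 𝒲] [Fintype 𝒰] [Fintype 𝒱]

/-- The one-shot bound on the error probability of a random code with codewords drawn from `Q` and
threshold decoding, when two helper observations share a bin with probability at most `c`. -/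
def randomCodingBound (p : PMF (𝒳 × 𝒴)) (Q : PMF 𝒲) (S : 𝒲 → PMF 𝒰) (φ : 𝒲 → 𝒱)
    (c s t t' : ℝ) : ℝ :=
  pr p (fun z => ¬Likely p s z.1 z.2) + mean Q (fun w => pr (S w) fun u => ¬Exceeds Q S t w u) +
    mean Q (fun w => pr (genieChannel φ S w) fun b => ¬Exceeds Q (genieChannel φ S) t' w b) +
    s⁻¹ * (c * t⁻¹ + t'⁻¹)

theorem mean_binningError_le_randomCodingBound [Nonempty 𝒳] [DecidableEq 𝒳] [DecidableEq 𝒱]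
    (C : Type*) [Fintype C] [Nonempty C] (p : PMF (𝒳 × 𝒴)) (Q : PMF 𝒲) (S : 𝒲 → PMF 𝒰) (φ : 𝒲 → 𝒱)
    {s t t' : ℝ} (hs : 0 < s) (ht : 0 < t) (ht' : 0 < t') :
    mean (iid 𝒳 Q) (binningError (Likely p s) (Exceeds Q S t) (Exceeds Q (genieChannel φ S) t') φ
      C p S) ≤ randomCodingBound p Q S φ (Fintype.card C : ℝ)⁻¹ s t t' := by
  refine (mean_binningError_le _ _ _ φ p Q S (sum_ind_likely_le p hs)).trans ?_
  have h_receiver := mean_pr_exceeds_le Q S ht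
  have h_genie := mean_pr_exceeds_le Q (genieChannel φ S) ht'
  simp only [genieChannel, pr_map, randomCodingBound] at h_genie ⊢
  gcongr

end OneShotAchievability

section Asymptotics

/-- The pairs `(n_s, n_c)` of blocklengths with `n_c / n_s = κ`, as both tend to infinity. -/
def blocklengths (κ : ℚ) : Filter (ℕ × ℕ) :=
  atTop ×ˢ atTop ⊓ 𝓟 {b | (b.2 : ℚ) / (b.1 : ℚ) = κ}

theorem tendsto_fst_blocklengths (κ : ℚ) : Tendsto Prod.fst (blocklengths κ) atTop :=
  tendsto_fst.mono_left inf_le_left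

theorem tendsto_snd_blocklengths (κ : ℚ) : Tendsto Prod.snd (blocklengths κ) atTop :=
  tendsto_snd.mono_left inf_le_left

theorem eventually_blocklengths_pos (κ : ℚ) : ∀ᶠ b in blocklengths κ, 0 < b.1 ∧ 0 < b.2 :=
  ((tendsto_fst_blocklengths κ).eventually (eventually_gt_atTop 0)).and
    ((tendsto_snd_blocklengths κ).eventually (eventually_gt_atTop 0))

theorem eventually_snd_eq_mul_fst (κ : ℚ) :
    ∀ᶠ b in blocklengths κ, (b.2 : ℝ) = κ * b.1 := by
  filter_upwards [eventually_blocklengths_pos κ, mem_inf_of_right (mem_principal_self _)]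
    with b h_pos h_ratio
  rw [← show (b.2 : ℚ) / (b.1 : ℚ) = κ from h_ratio]
  push_cast
  rw [div_mul_cancel₀ _ (Nat.cast_pos.2 h_pos.1).ne']

theorem numMessages_pos (n : ℕ) {r : ℝ} (hr : 0 ≤ r) : 0 < numMessages n r :=
  Nat.floor_pos.2 (Real.one_le_rpow one_le_two (by positivity))

theorem inv_numMessages_le (n : ℕ) {r : ℝ} (hr : 0 ≤ r) :
    (numMessages n r : ℝ)⁻¹ ≤ 2 * (2 : ℝ) ^ (-(n * r)) := by
  have h_one : (1 : ℝ) ≤ numMessages n r := Nat.one_le_cast.2 (numMessages_pos n hr)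
  have h_floor : (2 : ℝ) ^ (n * r) < numMessages n r + 1 := Nat.lt_floor_add_one _
  rw [Real.rpow_neg zero_le_two, ← div_eq_mul_inv, inv_le_comm₀ (by positivity) (by positivity),
    inv_div, div_le_iff₀ two_pos]
  linarith

theorem tendsto_two_rpow_mul {c : ℝ} (hc : c < 0) :
    Tendsto (fun n : ℕ => (2 : ℝ) ^ (n * c)) atTop (𝓝 0) := by
  simp only [mul_comm _ c, Real.rpow_mul_natCast zero_le_two]
  exact tendsto_pow_atTop_nhds_zero_of_lt_one (by positivity)
    (Real.rpow_lt_one_of_one_lt_of_neg one_lt_two hc)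

theorem tendsto_false_candidates {κ : ℚ} {a r t t' : ℝ} (hr : 0 ≤ r) (ht : a < κ * t + r)
    (ht' : a < κ * t') :
    Tendsto (fun b : ℕ × ℕ => ((2 : ℝ) ^ (b.1 * -a))⁻¹ *
      ((numMessages b.1 r : ℝ)⁻¹ * ((2 : ℝ) ^ (b.2 * t))⁻¹ + ((2 : ℝ) ^ (b.2 * t'))⁻¹))
      (blocklengths κ) (𝓝 0) := by
  have h_limit := (((tendsto_two_rpow_mul (sub_neg.2 ht)).const_mul 2).add
    (tendsto_two_rpow_mul (sub_neg.2 ht'))).comp (tendsto_fst_blocklengths κ)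
  rw [mul_zero, add_zero] at h_limit
  refine squeeze_zero' (.of_forall fun b => by positivity) ?_ h_limit
  filter_upwards [eventually_snd_eq_mul_fst κ] with b hb
  calc ((2 : ℝ) ^ (b.1 * -a))⁻¹ *
        ((numMessages b.1 r : ℝ)⁻¹ * ((2 : ℝ) ^ (b.2 * t))⁻¹ + ((2 : ℝ) ^ (b.2 * t'))⁻¹)
      ≤ ((2 : ℝ) ^ (b.1 * -a))⁻¹ *
        (2 * (2 : ℝ) ^ (-(b.1 * r)) * ((2 : ℝ) ^ (b.2 * t))⁻¹ + ((2 : ℝ) ^ (b.2 * t'))⁻¹) := by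
        gcongr
        exact inv_numMessages_le b.1 hr
    _ = 2 * (2 : ℝ) ^ (b.1 * (a - (κ * t + r))) + (2 : ℝ) ^ (b.1 * (a - κ * t')) := by
        simp only [← Real.rpow_neg zero_le_two, mul_add, mul_assoc, mul_left_comm _ (2 : ℝ),
          ← Real.rpow_add two_pos, hb]
        ring_nf

variable {α β δ γ : Type*}

theorem exceeds_map_iff {h : β → γ} (hh : Function.Injective h) (Q : PMF α) (S : α → PMF β)
    (t : ℝ) (w : α) (b : β) :
    Exceeds Q (fun w => (S w).map h) t w (h b) ↔ Exceeds Q S t w b := by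
  simp only [Exceeds, ← PMF.map_bind, mass_map_of_injective hh]

variable [Fintype α] [Fintype β] [Fintype δ]

theorem tendsto_mean_pr_not_exceeds_genieChannel (Q : PMF α) (S : α → PMF β) (φ : α → δ) {t : ℝ}
    (ht : t < channelInfo Q (genieChannel φ S)) :
    Tendsto (fun n : ℕ => mean (iid (Fin n) Q) fun w =>
      pr (genieChannel (fun w j => φ (w j)) (memoryless S) w) fun b =>
        ¬Exceeds (iid (Fin n) Q) (genieChannel (fun w j => φ (w j)) (memoryless S)) (2 ^ (n * t))
          w b) atTop (𝓝 0) := by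
  have h_block (n : ℕ) : genieChannel (fun w (j : Fin n) => φ (w j)) (memoryless S) = fun w =>
      (memoryless (genieChannel φ S) w).map fun b => (fun j => (b j).1, fun j => (b j).2) := by
    funext w
    rw [memoryless, genieChannel, memoryless]
    simp only [genieChannel, ← piLaw_map, PMF.map_comp]
    rfl
  have h_injective (n : ℕ) : Function.Injective fun b : Fin n → δ × β =>
      ((fun j => (b j).1, fun j => (b j).2) : (Fin n → δ) × (Fin n → β)) := fun b b' h =>
    funext fun j => Prod.ext (congrFun (congrArg Prod.fst h) j) (congrFun (congrArg Prod.snd h) j)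
  refine (tendsto_mean_pr_not_exceeds Q (genieChannel φ S) ht).congr fun n => ?_
  simp only [h_block, pr_map, exceeds_map_iff (h_injective n)]

theorem tendsto_randomCodingBound [Fintype γ] {κ : ℚ} (p : PMF (α × β)) (Q : PMF γ) {𝒰 : Type*}
    [Fintype 𝒰] (S : γ → PMF 𝒰) (φ : γ → δ) {a r t t' : ℝ} (hr : 0 ≤ r) (ha : equivocation p < a)
    (ht : t < channelInfo Q S) (ht' : t' < channelInfo Q (genieChannel φ S))
    (hat : a < κ * t + r) (hat' : a < κ * t') :
    Tendsto (fun b : ℕ × ℕ => randomCodingBound (blockSource b.1 p) (iid (Fin b.2) Q)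
      (memoryless S) (fun w j => φ (w j)) (numMessages b.1 r : ℝ)⁻¹ (2 ^ (b.1 * -a)) (2 ^ (b.2 * t))
      (2 ^ (b.2 * t'))) (blocklengths κ) (𝓝 0) := by
  have h_source := (tendsto_pr_not_likely p (neg_lt_neg ha)).comp (tendsto_fst_blocklengths κ)
  have h_receiver := (tendsto_mean_pr_not_exceeds Q S ht).comp (tendsto_snd_blocklengths κ)
  have h_genie := (tendsto_mean_pr_not_exceeds_genieChannel Q S φ ht').comp
    (tendsto_snd_blocklengths κ)
  have h_sum := ((h_source.add h_receiver).add h_genie).add (tendsto_false_candidates hr hat hat')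
  simp only [add_zero] at h_sum
  exact h_sum

end Asymptotics

section Achievability

variable {K : ℕ} {X W : Type*} {Y U V : Fin K → Type*} [Fintype X] [∀ k, Fintype (Y k)]
  [∀ k, Fintype (U k)]

theorem achievable_iff (P : PMF (X × ∀ k, Y k)) (T : W → PMF (∀ k, U k)) (κ : ℚ) (R : Fin K → ℝ)
    (φ : ∀ k, W → V k) : Achievable P T κ R φ ↔ ∀ ε : ℝ, 0 < ε → ∀ᶠ b in blocklengths κ,
      ∃ c : Code X W Y U V b.1 b.2 R, ∀ k, c.errorProb P T φ k ≤ ε := by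
  refine forall₂_congr fun ε _ => ?_
  rw [blocklengths, eventually_inf_principal, prod_atTop_atTop_eq,
    eventually_atTop_prod_self']
  exact exists_congr fun N => ⟨fun h ns hns nc hnc => h ns nc hns hnc,
    fun h ns nc hns hnc => h ns hns nc hnc⟩

variable [Fintype W] [∀ k, Fintype (V k)]

theorem exists_code_errorProb_le (P : PMF (X × ∀ k, Y k)) (T : W → PMF (∀ k, U k)) (PW : PMF W)
    {R : Fin K → ℝ} (hR : ∀ k, 0 ≤ R k) (φ : ∀ k, W → V k) (ns nc : ℕ) {s t t' : Fin K → ℝ}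
    (hs : ∀ k, 0 < s k) (ht : ∀ k, 0 < t k) (ht' : ∀ k, 0 < t' k) :
    ∃ c : Code X W Y U V ns nc R, ∀ k, c.errorProb P T φ k ≤
      ∑ k, randomCodingBound (blockSource ns (receiverSource P k)) (iid (Fin nc) PW)
        (memoryless (receiverChannel T k)) (fun w j => φ k (w j)) (numMessages ns (R k) : ℝ)⁻¹
        (s k) (t k) (t' k) := by
  classical
  have : Nonempty X := P.support_nonempty.to_type.map Prod.fst
  have h_bins (k : Fin K) : Nonempty (Fin (numMessages ns (R k))) :=
    Fin.pos_iff_nonempty.1 (numMessages_pos ns (hR k))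
  let ok (k : Fin K) := Likely (blockSource ns (receiverSource P k)) (s k)
  let A (k : Fin K) := Exceeds (iid (Fin nc) PW) (memoryless (receiverChannel T k)) (t k)
  let G (k : Fin K) := Exceeds (iid (Fin nc) PW)
    (genieChannel (fun w j => φ k (w j)) (memoryless (receiverChannel T k))) (t' k)
  let e (k : Fin K) (F : (Fin ns → X) → (Fin nc → W)) : ℝ :=
    binningError (ok k) (A k) (G k) (fun w j => φ k (w j)) (Fin (numMessages ns (R k)))
      (blockSource ns (receiverSource P k)) (memoryless (receiverChannel T k)) F
  have he (k : Fin K) (F) : 0 ≤ e k F := mean_nonneg fun _ => decodingError_nonneg _ _ _ _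
  obtain ⟨F, hF⟩ := exists_le_mean (iid (Fin ns → X) (iid (Fin nc) PW)) fun F => ∑ k, e k F
  choose f hf using fun k => exists_decodingError_le_binningError (ok k) (A k) (G k)
    (fun w j => φ k (w j)) (Fin (numMessages ns (R k))) (blockSource ns (receiverSource P k))
    (memoryless (receiverChannel T k)) F
  let c : Code X W Y U V ns nc R :=
    ⟨F, f, fun k => candidateDecoder (ok k) (A k) (G k) (fun w j => φ k (w j)) F (f k)⟩
  refine ⟨c, fun k => ?_⟩
  calc c.errorProb P T φ k ≤ e k F := by rw [c.errorProb_eq_receiver]; exact hf k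
    _ ≤ ∑ k, e k F := Finset.single_le_sum (fun k _ => he k F) (Finset.mem_univ k)
    _ ≤ ∑ k, mean (iid (Fin ns → X) (iid (Fin nc) PW)) (e k) := hF.trans_eq (mean_sum _ _ _)
    _ ≤ _ := Finset.sum_le_sum fun k _ =>
      (mean_binningError_le_randomCodingBound (Fin (numMessages ns (R k))) _ _ _ _ (hs k) (ht k)
        (ht' k)).trans_eq (by rw [Fintype.card_fin])

theorem exists_thresholds {H I J r κ : ℝ} (hκ : 0 < κ) (h : H < min (κ * I + r) (κ * J)) :
    ∃ a t t', H < a ∧ t < I ∧ t' < J ∧ a < κ * t + r ∧ a < κ * t' := by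
  obtain ⟨a, hHa, ha⟩ := exists_between h
  obtain ⟨h_receiver, h_genie⟩ := lt_min_iff.1 ha
  obtain ⟨t, hat, ht⟩ := exists_between ((div_lt_iff₀' hκ).2 (sub_lt_iff_lt_add.2 h_receiver))
  obtain ⟨t', hat', ht'⟩ := exists_between ((div_lt_iff₀' hκ).2 h_genie)
  exact ⟨a, t, t', hHa, ht, ht', sub_lt_iff_lt_add.1 ((div_lt_iff₀' hκ).1 hat),
    (div_lt_iff₀' hκ).1 hat'⟩

theorem achievable_of_lt_helperBound (P : PMF (X × ∀ k, Y k)) (T : W → PMF (∀ k, U k)) {κ : ℚ}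
    (hκ : 0 < κ) {R : Fin K → ℝ} (hR : ∀ k, 0 ≤ R k) (φ : ∀ k, W → V k) (PW : PMF W)
    (h : ∀ k, sourceEquivocation P k < helperBound PW T κ R φ k) : Achievable P T κ R φ := by
  simp only [sourceEquivocation_eq, helperBound_eq] at h
  choose a t t' ha ht ht' hat hat' using fun k => exists_thresholds (Rat.cast_pos.2 hκ) (h k)
  have h_bound := tendsto_finsetSum Finset.univ fun k _ =>
    tendsto_randomCodingBound (receiverSource P k) PW (receiverChannel T k) (φ k) (hR k) (ha k)
      (ht k) (ht' k) (hat k) (hat' k)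
  rw [Finset.sum_const_zero] at h_bound
  refine (achievable_iff P T κ R φ).2 fun ε hε => ?_
  filter_upwards [h_bound.eventually_le_const hε] with b hb
  obtain ⟨c, hc⟩ := exists_code_errorProb_le P T PW hR φ b.1 b.2
    (s := fun k => 2 ^ (b.1 * -a k)) (t := fun k => 2 ^ (b.2 * t k))
    (t' := fun k => 2 ^ (b.2 * t' k)) (fun k => by positivity) (fun k => by positivity)
    fun k => by positivity
  exact ⟨c, fun k => (hc k).trans hb⟩

end Achievability

/-! ### Converse -/

section OneShotConverse

theorem mean_logb_div_nonpos {α : Type*} [Fintype α] {r : PMF α} {t : α → ℝ} (ht : ∀ a, 0 ≤ t a)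
    (h_pos : ∀ a ∈ r.support, 0 < t a) (h_sum : ∑ a, t a ≤ 1) :
    mean r (fun a => logb 2 (t a / mass r a)) ≤ 0 := by
  have h_log : 0 < Real.log 2 := Real.log_pos one_lt_two
  calc mean r (fun a => logb 2 (t a / mass r a))
      ≤ mean r fun a => (t a / mass r a - 1) * (Real.log 2)⁻¹ := mean_mono fun a ha => by
        rw [logb, div_eq_mul_inv (Real.log _)]
        exact mul_le_mul_of_nonneg_right
          (Real.log_le_sub_one_of_pos (div_pos (h_pos a ha) (mass_pos_iff.2 ha)))
          (inv_nonneg.2 h_log.le)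
    _ = (mean r (fun a => t a / mass r a) - 1) * (Real.log 2)⁻¹ := by
        rw [mean_mul_const, mean_sub, mean_const]
    _ ≤ 0 := by
        refine mul_nonpos_of_nonpos_of_nonneg (sub_nonpos.2 (le_trans ?_ h_sum))
          (inv_nonneg.2 h_log.le)
        refine Finset.sum_le_sum fun a _ => ?_
        rcases (mass_nonneg r a).eq_or_lt' with ha | ha
        · rw [ha, zero_mul]
          exact ht a
        · rw [mul_div_cancel₀ _ ha.ne']

variable {𝒳 𝒴 𝒰 C : Type*} [Fintype 𝒳] [Fintype C]

/-- The posterior probability of the source symbol `x` assigned by an observer who knows the decoder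
`g` and its inputs `u` and `y`: it guesses the helper's message uniformly, and then mixes the
reconstruction with a uniformly distributed symbol. -/
def guessWeight (g : 𝒰 → 𝒴 → C → 𝒳) (u : 𝒰) (y : 𝒴) (x : 𝒳) : ℝ :=
  (Fintype.card C : ℝ)⁻¹ * ∑ m, (ind (g u y m = x) + (Fintype.card 𝒳 : ℝ)⁻¹) / 2

theorem sum_guessWeight_le_one (g : 𝒰 → 𝒴 → C → 𝒳) (u : 𝒰) (y : 𝒴) :
    ∑ x, guessWeight g u y x ≤ 1 := by
  have h_ind (m : C) : ∑ x, ind (g u y m = x) = 1 := by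
    simpa only [mul_one] using sum_ind_eq_mul (g u y m) fun _ => 1
  have h_guess (m : C) : ∑ x, (ind (g u y m = x) + (Fintype.card 𝒳 : ℝ)⁻¹) / 2 ≤ 1 := by
    rw [← Finset.sum_div, Finset.sum_add_distrib, h_ind, Finset.sum_const, Finset.card_univ,
      nsmul_eq_mul]
    linarith [mul_inv_le_one (a := (Fintype.card 𝒳 : ℝ))]
  simp only [guessWeight, ← Finset.mul_sum]
  rw [Finset.sum_comm]
  calc (Fintype.card C : ℝ)⁻¹ * ∑ m, ∑ x, (ind (g u y m = x) + (Fintype.card 𝒳 : ℝ)⁻¹) / 2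
      ≤ (Fintype.card C : ℝ)⁻¹ * ∑ _m : C, 1 := by gcongr; exact h_guess _
    _ ≤ 1 := by
      rw [Finset.sum_const, Finset.card_univ, nsmul_eq_mul, mul_one]
      exact inv_mul_le_one

theorem le_guessWeight (g : 𝒰 → 𝒴 → C → 𝒳) (u : 𝒰) (y : 𝒴) (x : 𝒳) (m : C) :
    (Fintype.card C : ℝ)⁻¹ * ((ind (g u y m = x) + (Fintype.card 𝒳 : ℝ)⁻¹) / 2) ≤
      guessWeight g u y x := by
  refine mul_le_mul_of_nonneg_left ?_ (by positivity)
  exact Finset.single_le_sum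
    (f := fun m => (ind (g u y m = x) + (Fintype.card 𝒳 : ℝ)⁻¹) / 2)
    (fun m _ => div_nonneg (add_nonneg (ind_nonneg _) (by positivity)) zero_le_two)
    (Finset.mem_univ m)

theorem guessWeight_pos [Nonempty 𝒳] [Nonempty C] (g : 𝒰 → 𝒴 → C → 𝒳) (u : 𝒰) (y : 𝒴) (x : 𝒳) :
    0 < guessWeight g u y x := by
  refine lt_of_lt_of_le ?_ (le_guessWeight g u y x (Classical.arbitrary C))
  have := ind_nonneg (g u y (Classical.arbitrary C) = x)
  positivity

theorem neg_logb_guessWeight_le (g : 𝒰 → 𝒴 → C → 𝒳) (u : 𝒰) (y : 𝒴) (x : 𝒳) (m : C) :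
    -logb 2 (guessWeight g u y x) ≤
      logb 2 (Fintype.card C) + 1 + ind (g u y m ≠ x) * logb 2 (Fintype.card 𝒳) := by
  have : Nonempty 𝒳 := ⟨x⟩
  have : Nonempty C := ⟨m⟩
  have h_lower : (Fintype.card C : ℝ)⁻¹ * (2⁻¹ * (Fintype.card 𝒳 : ℝ)⁻¹ ^ ind (g u y m ≠ x)) ≤
      guessWeight g u y x := by
    refine le_trans (mul_le_mul_of_nonneg_left ?_ (by positivity)) (le_guessWeight g u y x m)
    by_cases h : g u y m = x
    · rw [ind_of_true h, ind_of_false (not_not.2 h), Real.rpow_zero]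
      linarith [inv_nonneg.2 (Nat.cast_nonneg (α := ℝ) (Fintype.card 𝒳))]
    · rw [ind_of_false h, ind_of_true h, Real.rpow_one]
      linarith
  have h_log := Real.logb_le_logb_of_le one_lt_two (by positivity) h_lower
  rw [Real.logb_mul (by positivity) (by positivity), Real.logb_mul (by positivity) (by positivity),
    Real.logb_rpow_eq_mul_logb_of_pos (by positivity), Real.logb_inv, Real.logb_inv, Real.logb_inv,
    Real.logb_self_eq_one one_lt_two] at h_log
  linarith

variable [Fintype 𝒴] [Fintype 𝒰]

theorem sum_mul_guessWeight_le_one (py : PMF 𝒴) (q : PMF 𝒰) (g : 𝒰 → 𝒴 → C → 𝒳) :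
    ∑ s : (𝒳 × 𝒴) × 𝒰, mass py s.1.2 * mass q s.2 * guessWeight g s.2 s.1.2 s.1.1 ≤ 1 := by
  calc ∑ s : (𝒳 × 𝒴) × 𝒰, mass py s.1.2 * mass q s.2 * guessWeight g s.2 s.1.2 s.1.1
      = mean py fun y => mean q fun u => ∑ x, guessWeight g u y x := by
        simp only [Fintype.sum_prod_type_right, mean, Finset.mul_sum, mul_assoc]
        exact Finset.sum_comm
    _ ≤ mean py fun _ => mean q fun _ => 1 :=
        mean_mono fun y _ => mean_mono fun u _ => sum_guessWeight_le_one g u y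
    _ = 1 := by rw [mean_const, mean_const]

variable {p : PMF (𝒳 × 𝒴)} {S : 𝒳 → PMF 𝒰} {q : PMF 𝒰}

theorem mean_logb_guessWeight_le [Nonempty C]
    (hq : ∀ x ∈ (p.map Prod.fst).support, (S x).support ⊆ q.support) (g : 𝒰 → 𝒴 → C → 𝒳) :
    equivocation p + mean p (fun z => mean (S z.1) fun u => logb 2 (guessWeight g u z.2 z.1)) ≤
      mean (p.map Prod.fst) fun x => relEntropy (S x) q := by
  have : Nonempty 𝒳 := p.support_nonempty.to_type.map Prod.fst
  let t (s : (𝒳 × 𝒴) × 𝒰) : ℝ :=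
    mass (p.map Prod.snd) s.1.2 * mass q s.2 * guessWeight g s.2 s.1.2 s.1.1
  have h_pos (s : (𝒳 × 𝒴) × 𝒰) (hs : s ∈ (joint p fun z => S z.1).support) :
      0 < mass (p.map Prod.snd) s.1.2 ∧ 0 < mass q s.2 := by
    obtain ⟨hz, hu⟩ := mem_support_joint.1 hs
    exact ⟨mass_pos_iff.2 (mem_support_map_apply hz Prod.snd),
      mass_pos_iff.2 (hq s.1.1 (mem_support_map_apply hz Prod.fst) hu)⟩
  have h_gibbs := mean_logb_div_nonpos (r := joint p fun z => S z.1) (t := t)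
    (fun s => mul_nonneg (mul_nonneg (mass_nonneg _ _) (mass_nonneg _ _))
      (guessWeight_pos g _ _ _).le)
    (fun s hs => mul_pos (mul_pos (h_pos s hs).1 (h_pos s hs).2) (guessWeight_pos g _ _ _))
    (sum_mul_guessWeight_le_one _ q g)
  have h_split : mean (joint p fun z => S z.1) (fun s => logb 2 (t s / mass _ s)) =
      mean (joint p fun z => S z.1) fun s => logb 2 (mass (p.map Prod.snd) s.1.2 / mass p s.1) +
        logb 2 (guessWeight g s.2 s.1.2 s.1.1) - logb 2 (mass (S s.1.1) s.2 / mass q s.2) :=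
    mean_congr fun s hs => by
      have h_in := (mass_pos_iff.2 (mem_support_joint.1 hs).1).ne'
      have h_channel := (mass_pos_iff.2 (mem_support_joint.1 hs).2).ne'
      have h_side := (h_pos s hs).1.ne'
      have h_out := (h_pos s hs).2.ne'
      have h_weight := (guessWeight_pos g s.2 s.1.2 s.1.1).ne'
      rw [mass_joint p (fun z => S z.1) s.1 s.2, Real.logb_div h_side h_in,
        Real.logb_div h_channel h_out,
        Real.logb_div (mul_ne_zero (mul_ne_zero h_side h_out) h_weight)
          (mul_ne_zero h_in h_channel), Real.logb_mul (mul_ne_zero h_side h_out) h_weight,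
        Real.logb_mul h_side h_out, Real.logb_mul h_in h_channel]
      ring
  rw [h_split, mean_sub, mean_add, mean_joint, mean_joint, mean_joint] at h_gibbs
  simp only [mean_const] at h_gibbs
  simp only [mean_map, relEntropy, equivocation]
  linarith

theorem equivocation_le (hq : ∀ x ∈ (p.map Prod.fst).support, (S x).support ⊆ q.support)
    (m : 𝒳 → C) (g : 𝒰 → 𝒴 → C → 𝒳) :
    equivocation p ≤ mean (p.map Prod.fst) (fun x => relEntropy (S x) q) +
      logb 2 (Fintype.card C) + 1 + decodingError p S m g * logb 2 (Fintype.card 𝒳) := by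
  have : Nonempty C := p.support_nonempty.to_type.map fun z => m z.1
  have h_guess : -mean p (fun z => mean (S z.1) fun u => logb 2 (guessWeight g u z.2 z.1)) ≤
      logb 2 (Fintype.card C) + 1 + decodingError p S m g * logb 2 (Fintype.card 𝒳) := by
    calc -mean p (fun z => mean (S z.1) fun u => logb 2 (guessWeight g u z.2 z.1))
        = mean p fun z => mean (S z.1) fun u => -logb 2 (guessWeight g u z.2 z.1) := by
          simp only [mean_neg]
      _ ≤ mean p fun z => mean (S z.1) fun u => logb 2 (Fintype.card C) + 1 +
            ind (g u z.2 (m z.1) ≠ z.1) * logb 2 (Fintype.card 𝒳) :=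
          mean_mono fun z _ => mean_mono fun u _ => neg_logb_guessWeight_le g u z.2 z.1 (m z.1)
      _ = _ := by simp only [mean_add, mean_const, mean_mul_const, decodingError, pr]
  linarith [mean_logb_guessWeight_le hq g]

end OneShotConverse

section Additivity

variable {ι α β : Type*} [Fintype ι] [DecidableEq ι] [Fintype α] [Fintype β]

theorem mean_piLaw_logb_prod_div (p : ι → PMF α) {f g : ι → α → ℝ}
    (hf : ∀ i, ∀ a ∈ (p i).support, f i a ≠ 0) (hg : ∀ i, ∀ a ∈ (p i).support, g i a ≠ 0) :
    mean (piLaw p) (fun z => logb 2 ((∏ i, f i (z i)) / ∏ i, g i (z i))) =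
      ∑ i, mean (p i) fun a => logb 2 (f i a / g i a) := by
  rw [← mean_piLaw_sum]
  refine mean_congr fun z hz => ?_
  have hz' := mem_support_piLaw.1 hz
  rw [← Finset.prod_div_distrib, Real.logb_prod _ _ fun i _ =>
    div_ne_zero (hf i (z i) (hz' i)) (hg i (z i) (hz' i))]

theorem equivocation_blockSource (n : ℕ) (p : PMF (α × β)) :
    equivocation (blockSource n p) = n * equivocation p := by
  simp only [equivocation, mean_blockSource, map_snd_blockSource, mass_piLaw, mass_blockSource]
  rw [mean_piLaw_logb_prod_div (fun _ => p) (f := fun _ z => mass (p.map Prod.snd) z.2)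
    (g := fun _ z => mass p z)
    (fun _ z hz => (mass_pos_iff.2 (mem_support_map_apply hz Prod.snd)).ne')
    fun _ z hz => (mass_pos_iff.2 hz).ne', Finset.sum_const, Finset.card_univ, Fintype.card_fin,
    nsmul_eq_mul]

theorem relEntropy_piLaw {p q : ι → PMF α} (h : ∀ i, (p i).support ⊆ (q i).support) :
    relEntropy (piLaw p) (piLaw q) = ∑ i, relEntropy (p i) (q i) := by
  simp only [relEntropy, mass_piLaw]
  exact mean_piLaw_logb_prod_div p (fun _ _ ha => (mass_pos_iff.2 ha).ne')
    fun i _ ha => (mass_pos_iff.2 (h i ha)).ne'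

end Additivity

section AverageSymbol

variable {ι α : Type*} [Fintype ι] [Nonempty ι]

/-- The law of a letter of an `r`-distributed word, at a uniformly distributed position. -/
def averageSymbol (r : PMF (ι → α)) : PMF α :=
  (PMF.uniformOfFintype ι).bind fun i => r.map (· i)

theorem apply_mem_support_averageSymbol {r : PMF (ι → α)} {w : ι → α} (hw : w ∈ r.support)
    (i : ι) : w i ∈ (averageSymbol r).support :=
  (PMF.mem_support_bind_iff _ _ _).2
    ⟨i, PMF.mem_support_uniformOfFintype i, mem_support_map_apply hw (· i)⟩

theorem card_mul_mean_averageSymbol [DecidableEq ι] [Fintype α] (r : PMF (ι → α)) (f : α → ℝ) :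
    Fintype.card ι * mean (averageSymbol r) f = mean r fun w => ∑ i, f (w i) := by
  rw [averageSymbol, mean_bind, mean_sum]
  simp only [mean_map]
  simp only [mean, mass_uniformOfFintype, ← Finset.mul_sum]
  exact mul_inv_cancel_left₀ (Nat.cast_ne_zero.2 Fintype.card_ne_zero) _

end AverageSymbol

section BlockConverse

variable {α β γ δ C : Type*} [Fintype α] [Fintype β] [Fintype γ] [Fintype δ] [Fintype C]

theorem mul_equivocation_le {ns nc : ℕ} [NeZero nc] (p : PMF (α × β)) (S : γ → PMF δ)
    (enc : (Fin ns → α) → Fin nc → γ) (m : (Fin ns → α) → C)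
    (g : (Fin nc → δ) → (Fin ns → β) → C → Fin ns → α) :
    ns * equivocation p ≤
      nc * channelInfo (averageSymbol ((iid (Fin ns) (p.map Prod.fst)).map enc)) S +
        logb 2 (Fintype.card C) + 1 +
        decodingError (blockSource ns p) (fun x => memoryless S (enc x)) m g *
          (ns * logb 2 (Fintype.card α)) := by
  set r := (iid (Fin ns) (p.map Prod.fst)).map enc
  set Q := averageSymbol r
  have h_support (x : Fin ns → α) (hx : x ∈ (iid (Fin ns) (p.map Prod.fst)).support) (j : Fin nc) :
      (S (enc x j)).support ⊆ (Q.bind S).support :=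
    support_subset_support_bind Q S
      (apply_mem_support_averageSymbol (mem_support_map_apply hx enc) j)
  have h_information : mean (iid (Fin ns) (p.map Prod.fst)) (fun x =>
      relEntropy (memoryless S (enc x)) (iid (Fin nc) (Q.bind S))) = nc * channelInfo Q S := by
    have h_average := card_mul_mean_averageSymbol r fun w => relEntropy (S w) (Q.bind S)
    rw [Fintype.card_fin, mean_map] at h_average
    exact (mean_congr fun x hx => relEntropy_piLaw (h_support x hx)).trans h_average.symm
  have h_converse := equivocation_le (p := blockSource ns p) (q := iid (Fin nc) (Q.bind S))
    (S := fun x => memoryless S (enc x)) (fun x hx u hu => mem_support_piLaw.2 fun j =>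
      h_support x (map_fst_blockSource ns p ▸ hx) j (mem_support_piLaw.1 hu j)) m g
  rwa [equivocation_blockSource, map_fst_blockSource, h_information, Fintype.card_fun,
    Fintype.card_fin, Nat.cast_pow, Real.logb_pow] at h_converse

end BlockConverse

section Model

variable {K : ℕ} {X W : Type*} {Y U V : Fin K → Type*} [Fintype X] {ns nc : ℕ} {R : Fin K → ℝ}

theorem logb_numMessages_le (n : ℕ) {r : ℝ} (h : 0 < numMessages n r) :
    logb 2 (numMessages n r) ≤ n * r := by
  rw [Real.logb_le_iff_le_rpow one_lt_two (Nat.cast_pos.2 h)]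
  exact Nat.floor_le (by positivity)

/-- The law of the channel input at a uniformly distributed time. -/
def Code.averageInput [NeZero nc] (c : Code X W Y U V ns nc R) (P : PMF (X × ∀ k, Y k)) : PMF W :=
  averageSymbol ((iid (Fin ns) (P.map Prod.fst)).map c.enc)

variable [Fintype W] [∀ k, Fintype (Y k)] [∀ k, Fintype (U k)] [∀ k, Fintype (V k)] {κ : ℚ}

theorem Code.sourceEquivocation_le_helperBound_add [NeZero ns] [NeZero nc]
    (c : Code X W Y U V ns nc R) (P : PMF (X × ∀ k, Y k)) (T : W → PMF (∀ k, U k))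
    (φ : ∀ k, W → V k) (h_ratio : (nc : ℝ) = κ * ns) (k : Fin K) :
    sourceEquivocation P k ≤ helperBound (c.averageInput P) T κ R φ k +
      ((ns : ℝ)⁻¹ + c.errorProb P T φ k * logb 2 (Fintype.card X)) := by
  obtain ⟨x⟩ : Nonempty X := P.support_nonempty.to_type.map Prod.fst
  have h_messages := logb_numMessages_le ns
    (c.helper k fun j => φ k (c.enc (fun _ => x) j)).pos
  have h_receiver := mul_equivocation_le (receiverSource P k) (receiverChannel T k) c.enc
    (fun x => c.helper k fun j => φ k (c.enc x j)) (c.dec k)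
  have h_genie := mul_equivocation_le (receiverSource P k)
    (genieChannel (φ k) (receiverChannel T k)) c.enc (fun _ => ())
    fun b y _ => c.dec k (fun j => (b j).2) y (c.helper k fun j => (b j).1)
  rw [← c.errorProb_eq_receiver P T φ k, Fintype.card_fin, map_fst_receiverSource, h_ratio]
    at h_receiver
  rw [← c.errorProb_eq_genie P T φ k, Fintype.card_unit, Nat.cast_one, Real.logb_one,
    map_fst_receiverSource, h_ratio] at h_genie
  have h_pos : (0 : ℝ) < ns := Nat.cast_pos.2 (NeZero.pos ns)
  rw [sourceEquivocation_eq, helperBound_eq, ← min_add_add_right, le_min_iff]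
  constructor <;> refine le_of_mul_le_mul_left ?_ h_pos <;>
    simp only [mul_add, mul_inv_cancel₀ h_pos.ne', Code.averageInput] <;> linarith

end Model

section Compactness

variable {α β : Type*}

theorem exists_tendsto_mass_subseq [Finite α] (Q : ℕ → PMF α) :
    ∃ (Q' : PMF α) (ψ : ℕ → ℕ), StrictMono ψ ∧
      ∀ a, Tendsto (fun n => mass (Q (ψ n)) a) atTop (𝓝 (mass Q' a)) := by
  cases nonempty_fintype α
  obtain ⟨q, ⟨h_nonneg, h_sum⟩, ψ, hψ, h_limit⟩ := (isCompact_stdSimplex ℝ α).tendsto_subseq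
    (x := fun n => mass (Q n)) fun n => ⟨mass_nonneg _, sum_mass _⟩
  let Q' : PMF α := PMF.ofFintype (fun a => ENNReal.ofReal (q a)) <| by
    rw [← ENNReal.ofReal_sum_of_nonneg fun a _ => h_nonneg a, h_sum, ENNReal.ofReal_one]
  have h_mass (a : α) : mass Q' a = q a := by
    rw [mass, PMF.ofFintype_apply, ENNReal.toReal_ofReal (h_nonneg a)]
  exact ⟨Q', ψ, hψ, fun a => h_mass a ▸ tendsto_pi_nhds.1 h_limit a⟩

variable [Fintype α] [Fintype β]

theorem channelInfo_eq_sum_negMulLog_add (Q : PMF α) (S : α → PMF β) :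
    channelInfo Q S = (∑ b, Real.negMulLog (mass (Q.bind S) b)) / Real.log 2 +
      mean Q fun w => mean (S w) fun b => logb 2 (mass (S w) b) := by
  have h_output : (∑ b, Real.negMulLog (mass (Q.bind S) b)) / Real.log 2 =
      -mean Q fun w => mean (S w) fun b => logb 2 (mass (Q.bind S) b) := by
    rw [← mean_bind, mean, Finset.sum_div, ← Finset.sum_neg_distrib]
    exact Finset.sum_congr rfl fun b _ => by rw [Real.negMulLog, logb]; ring
  rw [h_output, neg_add_eq_sub, ← mean_sub]
  refine mean_congr fun w hw => ?_
  rw [← mean_sub]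
  exact mean_congr fun b hb => Real.logb_div (mass_pos_iff.2 hb).ne'
    (mass_pos_iff.2 (support_subset_support_bind Q S hw hb)).ne'

variable {ι : Type*} {l : Filter ι} {Q : ι → PMF α} {Q' : PMF α}

theorem tendsto_mean (h : ∀ a, Tendsto (fun n => mass (Q n) a) l (𝓝 (mass Q' a))) (f : α → ℝ) :
    Tendsto (fun n => mean (Q n) f) l (𝓝 (mean Q' f)) :=
  tendsto_finsetSum _ fun a _ => (h a).mul_const (f a)

theorem tendsto_channelInfo (h : ∀ a, Tendsto (fun n => mass (Q n) a) l (𝓝 (mass Q' a)))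
    (S : α → PMF β) : Tendsto (fun n => channelInfo (Q n) S) l (𝓝 (channelInfo Q' S)) := by
  simp only [channelInfo_eq_sum_negMulLog_add, mass_bind]
  exact ((tendsto_finsetSum _ fun b _ => (Real.continuous_negMulLog.tendsto _).comp
    (tendsto_mean h _)).div_const _).add (tendsto_mean h _)

end Compactness

section Converse

theorem neBot_blocklengths {κ : ℚ} (hκ : 0 < κ) : (blocklengths κ).NeBot := by
  have h_num : (κ.num.toNat : ℚ) = κ.num := by
    exact_mod_cast Int.toNat_of_nonneg (Rat.num_pos.2 hκ).le
  have h_num_pos : 0 < κ.num.toNat := Int.pos_iff_toNat_pos.1 (Rat.num_pos.2 hκ)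
  have h_ratio : ∀ᶠ n : ℕ in atTop,
      ((n * κ.num.toNat : ℕ) : ℚ) / ((n * κ.den : ℕ) : ℚ) = κ := by
    filter_upwards [eventually_gt_atTop 0] with n hn
    rw [Nat.cast_mul, Nat.cast_mul, mul_div_mul_left _ _ (Nat.cast_pos.2 hn).ne', h_num,
      Rat.num_div_den]
  have h_tendsto : Tendsto (fun n : ℕ => (n * κ.den, n * κ.num.toNat)) atTop (blocklengths κ) :=
    tendsto_inf.2 ⟨(tendsto_id.atTop_mul_const' κ.den_pos).prodMk
      (tendsto_id.atTop_mul_const' h_num_pos), tendsto_principal.2 h_ratio⟩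
  exact h_tendsto.neBot

variable {K : ℕ} {X W : Type*} {Y U V : Fin K → Type*} [Fintype X] [∀ k, Fintype (Y k)]
  [∀ k, Fintype (U k)] {P : PMF (X × ∀ k, Y k)} {T : W → PMF (∀ k, U k)} {κ : ℚ} {R : Fin K → ℝ}
  {φ : ∀ k, W → V k}

theorem weaklyAchievable_iff (P : PMF (X × ∀ k, Y k)) (T : W → PMF (∀ k, U k)) (κ : ℚ)
    (R : Fin K → ℝ) (φ : ∀ k, W → V k) :
    WeaklyAchievable P T κ R φ ↔ ∀ ε : ℝ, 0 < ε → ∃ᶠ b in blocklengths κ,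
      ∃ c : Code X W Y U V b.1 b.2 R, ∀ k, c.errorProb P T φ k ≤ ε := by
  refine forall₂_congr fun ε _ => ?_
  rw [blocklengths, Filter.Frequently, eventually_inf_principal, prod_atTop_atTop_eq,
    eventually_atTop_prod_self', not_exists]
  refine forall_congr' fun N => ?_
  push Not
  simp only [exists_and_left]
  rfl

theorem Achievable.weaklyAchievable (hκ : 0 < κ) (h : Achievable P T κ R φ) :
    WeaklyAchievable P T κ R φ := by
  have := neBot_blocklengths hκ
  exact (weaklyAchievable_iff P T κ R φ).2 fun ε hε =>
    ((achievable_iff P T κ R φ).1 h ε hε).frequently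

variable [Fintype W] [∀ k, Fintype (V k)]

theorem WeaklyAchievable.exists_le_helperBound_add (h : WeaklyAchievable P T κ R φ) {δ : ℝ}
    (hδ : 0 < δ) :
    ∃ PW : PMF W, ∀ k, sourceEquivocation P k ≤ helperBound PW T κ R φ k + δ := by
  have h_card : 0 ≤ logb 2 (Fintype.card X) :=
    div_nonneg (Real.log_natCast_nonneg _) (Real.log_nonneg one_le_two)
  let ε := δ / 2 / (logb 2 (Fintype.card X) + 1)
  have h_error : ε * logb 2 (Fintype.card X) ≤ δ / 2 := by
    rw [div_mul_eq_mul_div, div_le_iff₀ (by positivity)]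
    gcongr
    linarith
  have h_length : ∀ᶠ b in blocklengths κ, (b.1 : ℝ)⁻¹ ≤ δ / 2 :=
    (tendsto_inv_atTop_nhds_zero_nat.comp (tendsto_fst_blocklengths κ)).eventually_le_const
      (half_pos hδ)
  obtain ⟨b, ⟨c, hc⟩, h_ratio, h_pos, h_length⟩ :=
    (((weaklyAchievable_iff P T κ R φ).1 h ε (by positivity)).and_eventually
      ((eventually_snd_eq_mul_fst κ).and ((eventually_blocklengths_pos κ).and h_length))).exists
  have : NeZero b.1 := ⟨h_pos.1.ne'⟩
  have : NeZero b.2 := ⟨h_pos.2.ne'⟩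
  refine ⟨c.averageInput P, fun k => (c.sourceEquivocation_le_helperBound_add P T φ h_ratio k).trans
    (add_le_add_right ?_ _)⟩
  linarith [mul_le_mul_of_nonneg_right (hc k) h_card]

theorem WeaklyAchievable.exists_le_helperBound (h : WeaklyAchievable P T κ R φ) :
    ∃ PW : PMF W, ∀ k, sourceEquivocation P k ≤ helperBound PW T κ R φ k := by
  choose Q hQ using fun n : ℕ =>
    h.exists_le_helperBound_add (Nat.one_div_pos_of_nat (α := ℝ) (n := n))
  obtain ⟨PW, ψ, hψ, h_limit⟩ := exists_tendsto_mass_subseq Q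
  refine ⟨PW, fun k => ?_⟩
  have h_slack := tendsto_one_div_add_atTop_nhds_zero_nat (𝕜 := ℝ).comp hψ.tendsto_atTop
  have h_bound : Tendsto (fun n => helperBound (Q (ψ n)) T κ R φ k) atTop
      (𝓝 (helperBound PW T κ R φ k)) := by
    simp only [helperBound_eq]
    exact (((tendsto_channelInfo h_limit _).const_mul _).add_const _).min
      ((tendsto_channelInfo h_limit _).const_mul _)
  exact ge_of_tendsto' (add_zero (helperBound PW T κ R φ k) ▸ h_bound.add h_slack)
    fun n => hQ (ψ n) k

end Converse

end BSCoop

end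

theorem theorem1 {K : ℕ} {X W : Type*} {Y U V : Fin K → Type*}
    [Fintype X] [Fintype W] [∀ k, Fintype (Y k)] [∀ k, Fintype (U k)] [∀ k, Fintype (V k)]
    (P : PMF (X × (∀ k, Y k))) (T : W → PMF (∀ k, U k))
    (κ : ℚ) (hκ : 0 < κ) (R : Fin K → ℝ) (hR : ∀ k, 0 ≤ R k) (φ : ∀ k, W → V k) :
    ((∃ PW : PMF W, ∀ k,
        BSCoop.sourceEquivocation P k < BSCoop.helperBound PW T κ R φ k) →
      BSCoop.Achievable P T κ R φ) ∧
    (BSCoop.Achievable P T κ R φ →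
      ∃ PW : PMF W, ∀ k,
        BSCoop.sourceEquivocation P k ≤ BSCoop.helperBound PW T κ R φ k) ∧
    (BSCoop.WeaklyAchievable P T κ R φ →
      ∃ PW : PMF W, ∀ k,
        BSCoop.sourceEquivocation P k ≤ BSCoop.helperBound PW T κ R φ k) :=
  ⟨fun ⟨PW, h⟩ => BSCoop.achievable_of_lt_helperBound P T hκ hR φ PW h,
    fun h => (h.weaklyAchievable hκ).exists_le_helperBound, fun h => h.exists_le_helperBound⟩
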